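/- An edge periodic graph (EPG) $\mathcal{G}=(V,E,\tau)$ consists of a finite simple undirected graph $G=(V,E)$ and a map $\tau:E\to\{0,1\}^*$ such that every word $\tau(e)$ contains at least one $1$. For a time step $t\in\{0,1,2,\dots\}$, the snapshot $\mathcal{G}(t)$ is the graph with vertex set $V$ whose edges are those $e\in E$ for which the letter of $\tau(e)$ at position $t \bmod |\tau(e)|$ (positions counted from $0$) is $1$. Let $\#1_{\max}$ and $\#0_{\max}$ denote the maximal number of ones and of zeros, respectively, in a word $\tau(e)$, over all $e\in E$ (both are $0$ if $E=\emptyset$). A graph $H$ is a minor of a graph $F$ if a graph isomorphic to $H$ can be obtained from $F$ by deleting vertices, deleting edges and contracting edges. Consider the following four decision problems, whose input is an EPG $\mathcal{G}=(V,E,\tau)$, with its edge labels written out as words, and a finite simple graph $H$: - EPG-Subgraph: is there a time step $t$ such that $\mathcal{G}(t)$ contains an induced subgraph isomorphic to $H$? - EPG-Subgraph-Free: is there a time step $t$ such that $\mathcal{G}(t)$ contains no induced subgraph isomorphic to $H$? - EPG-Minor: is there a time step $t$ such that $H$ is a minor of $\mathcal{G}(t)$? - EPG-Minor-Free: is there a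 time step $t$ such that $H$ is not a minor of $\mathcal{G}(t)$? Theorem. Each of these four problems is fixed-parameter tractable with respect to the combined parameter $k=|V|+\min(\#1_{\max},\#0_{\max})$; that is, for each of them there are a deterministic algorithm (a random access machine with unit-cost addition, subtraction and halving, a model polynomially equivalent to Turing machines), a computable function $f:\mathbb{N}\to\mathbb{N}$ and a polynomial $p$ such that the algorithm decides every instance correctly in at most $f(k)\cdot p(N)$ steps, where $N$ is the length of the encoding of the instance. -/

import Mathlib

/-! ### Machine model

Programs for a random access machine with finitely many named registers and an unbounded indirectly
addressed memory, both holding natural numbers. The arithmetic operations are addition, truncated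
subtraction and halving, each at unit cost; there is deliberately no multiplication. In `T` steps
numbers can gain only `O(T)` bits, so the model is polynomially equivalent to Turing machines. -/

namespace RAM

/-- A machine state: registers and memory. -/
structure State where
  reg : ℕ → ℕ
  mem : ℕ → ℕ

/-- Arithmetic expressions. -/
inductive Expr where
  | const (k : ℕ)
  | reg (i : ℕ)
  | read (address : Expr)
  | add (a b : Expr)
  | sub (a b : Expr)
  | half (a : Expr)

/-- The value of an expression in a state. -/
def Expr.eval (s : State) : Expr → ℕ
  | .const k => k
  | .reg i => s.reg i
  | .read a => s.mem (a.eval s)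
  | .add a b => a.eval s + b.eval s
  | .sub a b => a.eval s - b.eval s
  | .half a => a.eval s / 2

/-- The number of elementary operations needed to evaluate an expression. -/
def Expr.cost : Expr → ℕ
  | .const _ => 1
  | .reg _ => 1
  | .read a => a.cost + 1
  | .add a b => a.cost + b.cost + 1
  | .sub a b => a.cost + b.cost + 1
  | .half a => a.cost + 1

/-- Programs. A guard counts as true when its value is nonzero. -/
inductive Program where
  | skip
  | assign (i : ℕ) (e : Expr)
  | write (address e : Expr)
  | seq (p q : Program)
  | branch (guard : Expr) (p q : Program)
  | loop (guard : Expr) (body : Program)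

/-- `Run p s s' T`: started in state `s`, the program `p` halts in state `s'` after exactly
`T` steps. -/
inductive Run : Program → State → State → ℕ → Prop where
  | skip (s : State) : Run .skip s s 1
  | assign (s : State) (i : ℕ) (e : Expr) :
      Run (.assign i e) s ⟨Function.update s.reg i (e.eval s), s.mem⟩ (e.cost + 1)
  | write (s : State) (a e : Expr) :
      Run (.write a e) s ⟨s.reg, Function.update s.mem (a.eval s) (e.eval s)⟩
        (a.cost + e.cost + 1)
  | seq {p q : Program} {s s' s'' : State} {T T' : ℕ} :
      Run p s s' T → Run q s' s'' T' → Run (.seq p q) s s'' (T + T')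
  | branch_true {g : Expr} {p q : Program} {s s' : State} {T : ℕ} :
      g.eval s ≠ 0 → Run p s s' T → Run (.branch g p q) s s' (g.cost + 1 + T)
  | branch_false {g : Expr} {p q : Program} {s s' : State} {T : ℕ} :
      g.eval s = 0 → Run q s s' T → Run (.branch g p q) s s' (g.cost + 1 + T)
  | loop_done {g : Expr} {p : Program} {s : State} :
      g.eval s = 0 → Run (.loop g p) s s (g.cost + 1)
  | loop_step {g : Expr} {p : Program} {s s' s'' : State} {T T' : ℕ} :
      g.eval s ≠ 0 → Run p s s' T → Run (.loop g p) s' s'' T' →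
        Run (.loop g p) s s'' (g.cost + 1 + T + T')

/-- The machine is deterministic: final state and number of steps are determined by program and
initial state. -/
theorem Run.deterministic {p : Program} {s s₁ s₂ : State} {T₁ T₂ : ℕ}
    (h₁ : Run p s s₁ T₁) (h₂ : Run p s s₂ T₂) : s₁ = s₂ ∧ T₁ = T₂ := by
  induction h₁ generalizing s₂ T₂ with
  | skip => cases h₂; exact ⟨rfl, rfl⟩
  | assign => cases h₂; exact ⟨rfl, rfl⟩
  | write => cases h₂; exact ⟨rfl, rfl⟩
  | seq _ _ ih ih' =>
    cases h₂ with
    | seq k k' =>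
      obtain ⟨rfl, rfl⟩ := ih k
      obtain ⟨rfl, rfl⟩ := ih' k'
      exact ⟨rfl, rfl⟩
  | branch_true h _ ih =>
    cases h₂ with
    | branch_true _ k => obtain ⟨rfl, rfl⟩ := ih k; exact ⟨rfl, rfl⟩
    | branch_false h' _ => exact absurd h' h
  | branch_false h _ ih =>
    cases h₂ with
    | branch_true h' _ => exact absurd h h'
    | branch_false _ k => obtain ⟨rfl, rfl⟩ := ih k; exact ⟨rfl, rfl⟩
  | loop_done h =>
    cases h₂ with
    | loop_done => exact ⟨rfl, rfl⟩
    | loop_step h' _ _ => exact absurd h h'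
  | loop_step h _ _ ih ih' =>
    cases h₂ with
    | loop_done h' => exact absurd h' h
    | loop_step _ k k' =>
      obtain ⟨rfl, rfl⟩ := ih k
      obtain ⟨rfl, rfl⟩ := ih' k'
      exact ⟨rfl, rfl⟩

/-- The initial state on input word `w`: register `0` holds the length of `w`, memory cell `i` holds
the `i`-th letter of `w`, and everything else is `0`. -/
def State.init (w : List (Fin 3)) : State where
  reg i := if i = 0 then w.length else 0
  mem i := (w[i]?.map Fin.val).getD 0

end RAM

/-! ### Fixed-parameter tractability -/

/-- A parameterized decision problem: instances, their encoding as words over a three-letter alphabet,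
the parameter, and the yes-instances. -/
structure ParamProblem where
  Instance : Type
  encode : Instance → List (Fin 3)
  param : Instance → ℕ
  Yes : Instance → Prop

/-- A parameterized problem is fixed-parameter tractable if a single program decides every instance
(answering `1` or `0` in register `0`) in at most `f(k) · p(N)` steps, where `k` is the parameter,
`N` the length of the encoding, `f` a computable function and `p` a polynomial. -/
def ParamProblem.IsFPT (P : ParamProblem) : Prop :=
  ∃ (A : RAM.Program) (f : ℕ → ℕ) (p : Polynomial ℕ), Computable f ∧
    ∀ x : P.Instance, ∃ (s : RAM.State) (T : ℕ),
      RAM.Run A (RAM.State.init (P.encode x)) s T ∧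
      T ≤ f (P.param x) * p.eval (P.encode x).length ∧
      (P.Yes x → s.reg 0 = 1) ∧ (¬ P.Yes x → s.reg 0 = 0)

/-! ### Minors -/

/-- Contraction of the edge `uv`: the vertex `v` is removed and `u` takes over its neighbours. -/
def SimpleGraph.contractEdge {V : Type} (G : SimpleGraph V) (u v : V) :
    SimpleGraph {x : V // x ≠ v} where
  Adj x y := x ≠ y ∧
    (G.Adj x y ∨ ((x : V) = u ∧ G.Adj v y) ∨ ((y : V) = u ∧ G.Adj v x))
  symm := ⟨by
    rintro x y ⟨hne, h⟩
    refine ⟨hne.symm, ?_⟩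
    rcases h with h | h | h
    · exact Or.inl h.symm
    · exact Or.inr (Or.inr h)
    · exact Or.inr (Or.inl h)⟩
  loopless := ⟨fun _ h => h.1 rfl⟩

/-- `H.IsMinorOf G`: a graph isomorphic to `H` arises from `G` by a finite sequence of vertex
deletions, edge deletions and edge contractions. -/
inductive SimpleGraph.IsMinorOf {W : Type} (H : SimpleGraph W) :
    {V : Type} → SimpleGraph V → Prop where
  | iso {V : Type} {G : SimpleGraph V} : Nonempty (H ≃g G) → H.IsMinorOf G
  | deleteVertex {V : Type} {G : SimpleGraph V} (v : V) :
      H.IsMinorOf (G.induce {x | x ≠ v}) → H.IsMinorOf G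
  | deleteEdge {V : Type} {G : SimpleGraph V} (e : Sym2 V) :
      e ∈ G.edgeSet → H.IsMinorOf (G.deleteEdges {e}) → H.IsMinorOf G
  | contract {V : Type} {G : SimpleGraph V} (u v : V) :
      G.Adj u v → H.IsMinorOf (G.contractEdge u v) → H.IsMinorOf G

/-! ### Edge periodic graphs -/

/-- The letter at position `t` of the periodic repetition of `w` (irrelevant default for empty `w`). -/
def periodicLetter (w : List Bool) (t : ℕ) : Bool :=
  w.getD (t % w.length) false

/-- An edge periodic graph on `V`: an underlying graph whose edges are labelled by binary words, each
containing at least one `1`. -/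
structure EPG (V : Type) where
  graph : SimpleGraph V
  label : graph.edgeSet → List Bool
  one_mem : ∀ e, true ∈ label e

namespace EPG

variable {V : Type}

/-- The snapshot `𝒢(t)`: all vertices, and the edges present at time `t`. -/
def snapshot (𝒢 : EPG V) (t : ℕ) : SimpleGraph V where
  Adj u v := ∃ h : s(u, v) ∈ 𝒢.graph.edgeSet, periodicLetter (𝒢.label ⟨s(u, v), h⟩) t = true
  symm := ⟨fun u v h => by rw [Sym2.eq_swap]; exact h⟩
  loopless := ⟨fun _ ⟨h, _⟩ => 𝒢.graph.loopless.irrefl _ h⟩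

/-- The maximal number of ones in an edge label (`0` if there is no edge), for finite `V`. -/
noncomputable def maxOnes (𝒢 : EPG V) : ℕ := ⨆ e, (𝒢.label e).count true

/-- The maximal number of zeros in an edge label (`0` if there is no edge), for finite `V`. -/
noncomputable def maxZeros (𝒢 : EPG V) : ℕ := ⨆ e, (𝒢.label e).count false

open Classical in
/-- The label of the edge `uv` as a word over `{0, 1}`; the empty word if `uv` is not an edge. -/
noncomputable def labelWord (𝒢 : EPG V) (u v : V) : List (Fin 3) :=
  if h : s(u, v) ∈ 𝒢.graph.edgeSet then
    (𝒢.label ⟨s(u, v), h⟩).map fun b => if b then 1 else 0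
  else []

/-- Encoding of an edge periodic graph on `n` vertices: `1ⁿ2`, followed by the `n × n` matrix of label
words, row by row, each word terminated by the letter `2`. -/
noncomputable def encode {n : ℕ} (𝒢 : EPG (Fin n)) : List (Fin 3) :=
  List.replicate n 1 ++ [2] ++
    (List.finRange n).flatMap fun u => (List.finRange n).flatMap fun v => 𝒢.labelWord u v ++ [2]

end EPG

open Classical in
/-- Encoding of a graph on `m` vertices: `1ᵐ2`, followed by the adjacency matrix, row by row. -/
noncomputable def SimpleGraph.encode {m : ℕ} (H : SimpleGraph (Fin m)) : List (Fin 3) :=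
  List.replicate m 1 ++ [2] ++
    (List.finRange m).flatMap fun u => (List.finRange m).map fun v => if H.Adj u v then 1 else 0

/-- An instance of each of the four problems: an edge periodic graph `𝒢` and a graph `H`. -/
structure EPGInstance where
  n : ℕ
  𝒢 : EPG (Fin n)
  m : ℕ
  H : SimpleGraph (Fin m)

namespace EPGInstance

/-- The encoding of an instance. -/
noncomputable def encode (x : EPGInstance) : List (Fin 3) := x.𝒢.encode ++ x.H.encode

/-- The parameter `|V| + min(#1_max, #0_max)`. -/
noncomputable def param (x : EPGInstance) : ℕ := x.n + min x.𝒢.maxOnes x.𝒢.maxZeros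

end EPGInstance

/-- Is `H` an induced subgraph of some snapshot? -/
noncomputable def EPGSubgraph : ParamProblem where
  Instance := EPGInstance
  encode := EPGInstance.encode
  param := EPGInstance.param
  Yes x := ∃ t : ℕ, x.H.IsIndContained (x.𝒢.snapshot t)

/-- Is there a snapshot that does not contain `H` as an induced subgraph? -/
noncomputable def EPGSubgraphFree : ParamProblem where
  Instance := EPGInstance
  encode := EPGInstance.encode
  param := EPGInstance.param
  Yes x := ∃ t : ℕ, ¬ x.H.IsIndContained (x.𝒢.snapshot t)

/-- Is `H` a minor of some snapshot? -/
noncomputable def EPGMinor : ParamProblem where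
  Instance := EPGInstance
  encode := EPGInstance.encode
  param := EPGInstance.param
  Yes x := ∃ t : ℕ, x.H.IsMinorOf (x.𝒢.snapshot t)

/-- Is there a snapshot that does not contain `H` as a minor? -/
noncomputable def EPGMinorFree : ParamProblem where
  Instance := EPGInstance
  encode := EPGInstance.encode
  param := EPGInstance.param
  Yes x := ∃ t : ℕ, ¬ x.H.IsMinorOf (x.𝒢.snapshot t)

/-!
A snapshot is determined by which positions of the rarer of the two letters the time step hits, so
by which of `K` congruences `t ≡ p [MOD L]` it satisfies, where `K` is bounded in terms of the
parameter and `L` ranges over the lengths of the labels. Guess the congruences that hold. By the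
Chinese remainder theorem their common solutions are the terms of an arithmetic progression, and a
term has to be found that avoids the residue classes of the other congruences. If `n` residue
classes miss some term, they miss one of the first `2 ^ n`: the product of the factors
`ζ ^ t - ζ ^ p`, one for each class, where `ζ` is a root of unity, is along the progression a sum of
`2 ^ n` geometric sequences, and such a sum is zero if its first `2 ^ n` terms are. Hence some pair
of a guess and one of `2 ^ K` terms reproduces any given snapshot, and each of these snapshots is
tested for the pattern by exhaustive search; for minors this is a search for branch sets, with
connectedness tested on cuts. The time steps are as large as a product of `K` label lengths, so
remainders are computed by school division on their binary digits.
-/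

/-! ### Functions computable in fixed-parameter time -/

section Bounds

/-- `c` is bounded by a computable function of the parameter `par` times a polynomial in the length
`len` of the input. -/
def FPTBounded {α : Type*} (len par c : α → ℕ) : Prop :=
  ∃ (f : ℕ → ℕ) (p : Polynomial ℕ), Computable f ∧ ∀ a, c a ≤ f (par a) * p.eval (len a)

/-- `c` is bounded by a computable function of the parameter `par`. -/
def ParamBounded {α : Type*} (par c : α → ℕ) : Prop :=
  ∃ f : ℕ → ℕ, Computable f ∧ ∀ a, c a ≤ f (par a)

variable {α β : Type*} {len par c c' : α → ℕ}

theorem computable_two_pow : Computable fun n : ℕ => 2 ^ n := by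
  have hrec : Primrec (Nat.rec 1 fun _ y => 2 * y : ℕ → ℕ) :=
    Primrec.nat_rec₁ 1 (Primrec.nat_mul.comp (Primrec.const 2) Primrec.snd)
  refine (hrec.of_eq fun n => ?_).to_comp
  induction n with
  | zero => rfl
  | succ n ih => rw [pow_succ', ← ih]

namespace ParamBounded

theorem mono (h : ParamBounded par c) (hc : ∀ a, c' a ≤ c a) : ParamBounded par c' :=
  let ⟨f, hf, h⟩ := h
  ⟨f, hf, fun a => (hc a).trans (h a)⟩

theorem param : ParamBounded par par := ⟨_, Computable.id, fun _ => le_rfl⟩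

theorem const (k : ℕ) : ParamBounded par fun _ => k :=
  ⟨fun _ => k, Computable.const k, fun _ => le_rfl⟩

theorem mul (h : ParamBounded par c) (h' : ParamBounded par c') :
    ParamBounded par fun a => c a * c' a :=
  let ⟨_, hf, h⟩ := h
  let ⟨_, hf', h'⟩ := h'
  ⟨_, Primrec.nat_mul.to_comp.comp hf hf', fun a => Nat.mul_le_mul (h a) (h' a)⟩

theorem add (h : ParamBounded par c) (h' : ParamBounded par c') :
    ParamBounded par fun a => c a + c' a :=
  let ⟨_, hf, h⟩ := h
  let ⟨_, hf', h'⟩ := h'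
  ⟨_, Primrec.nat_add.to_comp.comp hf hf', fun a => Nat.add_le_add (h a) (h' a)⟩

theorem two_pow (h : ParamBounded par c) : ParamBounded par fun a => 2 ^ c a :=
  let ⟨_, hf, h⟩ := h
  ⟨_, computable_two_pow.comp hf, fun a => Nat.pow_le_pow_right two_pos (h a)⟩

theorem fptBounded (h : ParamBounded par c) : FPTBounded len par c :=
  let ⟨f, hf, h⟩ := h
  ⟨f, 1, hf, fun a => by simpa using h a⟩

end ParamBounded

namespace FPTBounded

theorem mono (h : FPTBounded len par c) (hc : ∀ a, c' a ≤ c a) : FPTBounded len par c' :=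
  let ⟨f, p, hf, h⟩ := h
  ⟨f, p, hf, fun a => (hc a).trans (h a)⟩

theorem comp (h : FPTBounded len par c) (r : β → α) :
    FPTBounded (fun x => len (r x)) (fun x => par (r x)) fun x => c (r x) :=
  let ⟨f, p, hf, h⟩ := h
  ⟨f, p, hf, fun x => h (r x)⟩

theorem const (k : ℕ) : FPTBounded len par fun _ => k := (ParamBounded.const k).fptBounded

theorem length : FPTBounded len par len :=
  ⟨fun _ => 1, Polynomial.X, Computable.const 1, fun _ => by simp⟩

theorem add (h : FPTBounded len par c) (h' : FPTBounded len par c') :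
    FPTBounded len par fun a => c a + c' a := by
  obtain ⟨f, p, hf, h⟩ := h
  obtain ⟨f', p', hf', h'⟩ := h'
  refine ⟨_, p + p', Primrec.nat_add.to_comp.comp hf hf', fun a => ?_⟩
  calc c a + c' a ≤ f (par a) * p.eval (len a) + f' (par a) * p'.eval (len a) :=
        Nat.add_le_add (h a) (h' a)
    _ ≤ (f (par a) + f' (par a)) * p.eval (len a) + (f (par a) + f' (par a)) * p'.eval (len a) := by
        gcongr <;> omega
    _ = (f (par a) + f' (par a)) * (p + p').eval (len a) := by rw [Polynomial.eval_add, mul_add]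

theorem mul (h : FPTBounded len par c) (h' : FPTBounded len par c') :
    FPTBounded len par fun a => c a * c' a := by
  obtain ⟨f, p, hf, h⟩ := h
  obtain ⟨f', p', hf', h'⟩ := h'
  refine ⟨_, p * p', Primrec.nat_mul.to_comp.comp hf hf', fun a => ?_⟩
  refine (Nat.mul_le_mul (h a) (h' a)).trans_eq ?_
  rw [Polynomial.eval_mul, mul_mul_mul_comm]

end FPTBounded

end Bounds

namespace RAM

/-- `s'` arises from `s` by changing registers from `D` on only. -/
def State.AgreeBelow (D : ℕ) (s s' : State) : Prop :=
  (∀ i < D, s'.reg i = s.reg i) ∧ s'.mem = s.mem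

/-- Started in `s`, the program `p` halts within `C` steps with the value `v` in register `D`,
having changed neither the memory nor the registers below `D`. -/
def Program.Yields (p : Program) (s : State) (D v C : ℕ) : Prop :=
  ∃ s' T, Run p s s' T ∧ T ≤ C ∧ s'.reg D = v ∧ s.AgreeBelow D s'

/-- Run `p` for each value of the counter in register `D + 2`, up to the value of register `D`, and
move each time the result of `p` from register `D + 3` to the accumulator, register `D + 1`. -/
def Program.countingLoop (D : ℕ) (p : Program) : Program :=
  .loop (.sub (.reg D) (.reg (D + 2))) (.seq p
    (.seq (.assign (D + 1) (.reg (D + 3))) (.assign (D + 2) (.add (.reg (D + 2)) (.const 1)))))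

namespace State.AgreeBelow

variable {D E : ℕ} {s s' s'' : State}

theorem mono (h : s.AgreeBelow D s') (hE : E ≤ D) : s.AgreeBelow E s' :=
  ⟨fun i hi => h.1 i (hi.trans_le hE), h.2⟩

theorem trans (h : s.AgreeBelow D s') (h' : s'.AgreeBelow D s'') : s.AgreeBelow D s'' :=
  ⟨fun i hi => (h'.1 i hi).trans (h.1 i hi), h'.2.trans h.2⟩

theorem update (hE : E ≤ D) (v : ℕ) : s.AgreeBelow E ⟨Function.update s.reg D v, s.mem⟩ :=
  ⟨fun _ hi => Function.update_of_ne (hi.trans_le hE).ne _ _, rfl⟩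

end State.AgreeBelow

namespace Program.Yields

variable {p q : Program} {s : State} {D E v w C C' : ℕ} {g : Expr}

theorem mono (h : p.Yields s D v C) (hC : C ≤ C') : p.Yields s D v C' :=
  let ⟨s', T, hr, hT, h⟩ := h
  ⟨s', T, hr, hT.trans hC, h⟩

theorem assign (e : Expr) : (Program.assign D e).Yields s D (e.eval s) (e.cost + 1) :=
  ⟨_, _, .assign s D e, le_rfl, Function.update_self .., .update le_rfl _⟩

theorem seq (hED : E ≤ D) (hp : p.Yields s D v C)
    (hq : ∀ s', s.AgreeBelow D s' → s'.reg D = v → q.Yields s' E w C') :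
    (p.seq q).Yields s E w (C + C') := by
  obtain ⟨s', T, hr, hT, hv, hs'⟩ := hp
  obtain ⟨s'', T', hr', hT', hw, hs''⟩ := hq s' hs' hv
  exact ⟨s'', _, .seq hr hr', Nat.add_le_add hT hT', hw, (hs'.mono hED).trans hs''⟩

theorem branch_true (hg : g.eval s ≠ 0) (hp : p.Yields s D v C) :
    (Program.branch g p q).Yields s D v (g.cost + 1 + C) :=
  let ⟨s', _, hr, hT, h⟩ := hp
  ⟨s', _, .branch_true hg hr, Nat.add_le_add_left hT _, h⟩

theorem branch_false (hg : g.eval s = 0) (hq : q.Yields s D v C) :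
    (Program.branch g p q).Yields s D v (g.cost + 1 + C) :=
  let ⟨s', _, hr, hT, h⟩ := hq
  ⟨s', _, .branch_false hg hr, Nat.add_le_add_left hT _, h⟩

theorem countingLoop {n i r : ℕ} {acc : ℕ → ℕ}
    (hp : ∀ s' j, s.AgreeBelow (D + 1) s' → j < n → s'.reg (D + 1) = acc j → s'.reg (D + 2) = j →
      p.Yields s' (D + 3) (acc (j + 1)) C)
    (hn : s.reg D = n) (hir : i + r = n) (hacc : s.reg (D + 1) = acc i) (hi : s.reg (D + 2) = i) :
    (p.countingLoop D).Yields s (D + 1) (acc n) (r * (C + 10) + 4) := by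
  induction r generalizing s i with
  | zero =>
    refine ⟨s, _, .loop_done ?_, ?_, ?_, fun _ _ => rfl, rfl⟩
    · simp only [Expr.eval]
      omega
    · simp [Expr.cost]
    · rw [hacc, ← hir, Nat.add_zero]
  | succ r ih =>
    obtain ⟨s₁, T₁, hr₁, hT₁, hv₁, hs₁⟩ := hp s i ⟨fun _ _ => rfl, rfl⟩ (by omega) hacc hi
    let s₂ : State := ⟨Function.update (Function.update s₁.reg (D + 1) (s₁.reg (D + 3))) (D + 2)
      (i + 1), s₁.mem⟩
    have hbody : Run (.seq p (.seq (.assign (D + 1) (.reg (D + 3)))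
        (.assign (D + 2) (.add (.reg (D + 2)) (.const 1))))) s s₂ (T₁ + (2 + 4)) := by
      refine .seq hr₁ (.seq (.assign ..) ?_)
      simpa [Expr.eval, Expr.cost, s₂, hs₁.1 (D + 2) (by omega), hi] using
        Run.assign ⟨Function.update s₁.reg (D + 1) (s₁.reg (D + 3)), s₁.mem⟩ (D + 2)
          (.add (.reg (D + 2)) (.const 1))
    have hs₂ : s.AgreeBelow (D + 1) s₂ :=
      (hs₁.mono (by omega)).trans (.trans (.update le_rfl _) (.update (by omega) _))
    obtain ⟨s₃, T₃, hr₃, hT₃, hv₃, hs₃⟩ := ih (s := s₂) (i := i + 1)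
      (fun s' j hs' => hp s' j (hs₂.trans hs')) ((hs₂.1 D (by omega)).trans hn) (by omega)
      (by simp [s₂, hv₁]) (by simp [s₂])
    refine ⟨s₃, _, .loop_step ?_ hbody hr₃, ?_, hv₃, hs₂.trans hs₃⟩
    · simp only [Expr.eval]
      omega
    · have : (r + 1) * (C + 10) = r * (C + 10) + (C + 10) := by ring
      simp only [Expr.cost]
      omega

end Program.Yields

/-- The value stored at address `i` on input `w`; it is `0` beyond the end of `w`. -/
def letterAt (w : List (Fin 3)) (i : ℕ) : ℕ := (w[i]?.map Fin.val).getD 0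

/-- What is known about the state in which a subprogram starts, for a family `ι` of inputs: `ok a s`
says that the registers of `s` below `depth` hold the data belonging to the index `a`, which include
the length of the input, and that the memory holds the input. -/
structure Ctx {I : Type} (enc : I → List (Fin 3)) (par : I → ℕ) {α : Type} (ι : α → I) where
  depth : ℕ
  ok : α → State → Prop
  ok_of_agreeBelow : ∀ {a s s'}, ok a s → s.AgreeBelow depth s' → ok a s'
  depth_pos : 0 < depth
  reg_zero : ∀ {a s}, ok a s → s.reg 0 = (enc (ι a)).length
  mem_eq : ∀ {a s}, ok a s → s.mem = letterAt (enc (ι a))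

variable {I : Type} {enc : I → List (Fin 3)} {par : I → ℕ} {α : Type} {ι : α → I}

/-- `f` is computed in fixed-parameter time from the data of the context `Γ`: for every register `D`
outside of the context there is a program that puts the value of `f` into `D`. -/
def FPTComputable (Γ : Ctx enc par ι) (f : α → ℕ) : Prop :=
  ∀ D, Γ.depth ≤ D → ∃ (p : Program) (c : α → ℕ),
    FPTBounded (fun a => (enc (ι a)).length) (fun a => par (ι a)) c ∧
      ∀ a s, Γ.ok a s → p.Yields s D (f a) (c a)

/-- `P` is decided in fixed-parameter time from the data of the context `Γ`. -/
def FPTDecidable (Γ : Ctx enc par ι) (P : α → Prop) : Prop :=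
  ∃ f, FPTComputable Γ f ∧ ∀ a, f a ≠ 0 ↔ P a

/-- `b` can serve as the number of iterations of a loop. -/
structure LoopBound (Γ : Ctx enc par ι) (b : α → ℕ) : Prop where
  computable : FPTComputable Γ b
  bounded : FPTBounded (fun a => (enc (ι a)).length) (fun a => par (ι a)) b

/-- The values of `f` have few enough bits to loop over them. -/
def LogBounded (Γ : Ctx enc par ι) (f : α → ℕ) : Prop :=
  ∃ b, LoopBound Γ b ∧ ∀ a, f a < 2 ^ b a

/-- `Γ'` is the context `Γ` together with the counter of a loop with `b a` iterations. -/
structure InLoop {b : α → ℕ} (Γ' : Ctx enc par fun x : (a : α) × Fin (b a) => ι x.1)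
    (Γ : Ctx enc par ι) : Prop where
  depth_le : Γ.depth ≤ Γ'.depth
  ok : ∀ {x s}, Γ'.ok x s → Γ.ok x.1 s
  counter : LoopBound Γ' fun x => x.2

/-- The context in the body of a `countingLoop`. -/
def Ctx.loopBody (Γ : Ctx enc par ι) (D : ℕ) (b : α → ℕ) (acc : α → ℕ → ℕ) :
    Ctx enc par fun x : (a : α) × Fin (b a) => ι x.1 where
  depth := max Γ.depth (D + 3)
  ok x s := Γ.ok x.1 s ∧ s.reg (D + 1) = acc x.1 x.2 ∧ s.reg (D + 2) = x.2
  ok_of_agreeBelow := fun ⟨hs, hacc, hi⟩ h =>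
    ⟨Γ.ok_of_agreeBelow hs (h.mono (le_max_left _ _)),
      (h.1 _ (lt_max_of_lt_right (by omega))).trans hacc,
      (h.1 _ (lt_max_of_lt_right (by omega))).trans hi⟩
  depth_pos := lt_max_of_lt_left Γ.depth_pos
  reg_zero h := Γ.reg_zero h.1
  mem_eq h := Γ.mem_eq h.1

variable {Γ : Ctx enc par ι} {b f g : α → ℕ} {P Q : α → Prop}
  {Γ' : Ctx enc par fun x : (a : α) × Fin (b a) => ι x.1}

namespace FPTComputable

theorem lift (hf : FPTComputable Γ f) (E : InLoop Γ' Γ) : FPTComputable Γ' fun x => f x.1 :=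
  fun D hD =>
    let ⟨p, c, hc, H⟩ := hf D (E.depth_le.trans hD)
    ⟨p, fun x => c x.1, hc.comp Sigma.fst, fun x s hs => H x.1 s (E.ok hs)⟩

theorem const (k : ℕ) : FPTComputable Γ fun _ => k := fun D _ =>
  ⟨.assign D (.const k), _, .const 2, fun _ _ _ => .assign _⟩

theorem of_reg (i : ℕ) (h : ∀ a s, Γ.ok a s → s.reg i = f a) : FPTComputable Γ f := fun D _ =>
  ⟨.assign D (.reg i), _, .const 2, fun a s hs => h a s hs ▸ .assign _⟩

theorem length : FPTComputable Γ fun a => (enc (ι a)).length := of_reg 0 fun _ _ => Γ.reg_zero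

theorem unary (e : ℕ → Expr) (op : α → ℕ → ℕ) (k : ℕ) (hk : ∀ i, (e i).cost = k)
    (he : ∀ a s i, Γ.ok a s → (e i).eval s = op a (s.reg i)) (hf : FPTComputable Γ f) :
    FPTComputable Γ fun a => op a (f a) := by
  intro D hD
  obtain ⟨p, c, hc, H⟩ := hf D hD
  refine ⟨p.seq (.assign D (e D)), _, hc.add (.const (k + 1)), fun a s hs =>
    (H a s hs).seq le_rfl fun s' hs' hv => ?_⟩
  beta_reduce
  rw [← hv, ← he a s' D (Γ.ok_of_agreeBelow hs (hs'.mono hD)), ← hk D]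
  exact .assign _

theorem half (hf : FPTComputable Γ f) : FPTComputable Γ fun a => f a / 2 :=
  unary (fun i => .half (.reg i)) (fun _ x => x / 2) 2 (fun _ => rfl) (fun _ _ _ _ => rfl) hf

theorem letterAt (hf : FPTComputable Γ f) : FPTComputable Γ fun a => letterAt (enc (ι a)) (f a) :=
  unary (fun i => .read (.reg i)) (fun a x => RAM.letterAt (enc (ι a)) x) 2 (fun _ => rfl)
    (fun _ s i hs => congrFun (Γ.mem_eq hs) (s.reg i)) hf

theorem binary (e : ℕ → ℕ → Expr) (op : ℕ → ℕ → ℕ) (k : ℕ) (hk : ∀ i j, (e i j).cost = k)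
    (he : ∀ s i j, (e i j).eval s = op (s.reg i) (s.reg j)) (hf : FPTComputable Γ f)
    (hg : FPTComputable Γ g) : FPTComputable Γ fun a => op (f a) (g a) := by
  intro D hD
  obtain ⟨p, c, hc, H⟩ := hf D hD
  obtain ⟨p', c', hc', H'⟩ := hg (D + 1) (hD.trans D.le_succ)
  refine ⟨p.seq (p'.seq (.assign D (e D (D + 1)))), _, hc.add (hc'.add (.const (k + 1))),
    fun a s hs => (H a s hs).seq le_rfl fun s' hs' hv =>
      (H' a s' (Γ.ok_of_agreeBelow hs (hs'.mono hD))).seq D.le_succ fun s'' hs'' hv' => ?_⟩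
  beta_reduce
  rw [← hv, ← hv', ← hs''.1 D D.lt_succ_self, ← he, ← hk D (D + 1)]
  exact .assign _

theorem add (hf : FPTComputable Γ f) (hg : FPTComputable Γ g) :
    FPTComputable Γ fun a => f a + g a :=
  binary (fun i j => .add (.reg i) (.reg j)) (· + ·) 3 (fun _ _ => rfl) (fun _ _ _ => rfl) hf hg

theorem sub (hf : FPTComputable Γ f) (hg : FPTComputable Γ g) :
    FPTComputable Γ fun a => f a - g a :=
  binary (fun i j => .sub (.reg i) (.reg j)) (· - ·) 3 (fun _ _ => rfl) (fun _ _ _ => rfl) hf hg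

theorem max (hf : FPTComputable Γ f) (hg : FPTComputable Γ g) :
    FPTComputable Γ fun a => max (f a) (g a) := by
  simpa only [add_tsub_eq_max] using hf.add (hg.sub hf)

theorem min (hf : FPTComputable Γ f) (hg : FPTComputable Γ g) :
    FPTComputable Γ fun a => min (f a) (g a) := by
  simpa only [tsub_tsub_eq_min] using hf.sub (hf.sub hg)

theorem ite [DecidablePred P] (hP : FPTDecidable Γ P) (hf : FPTComputable Γ f)
    (hg : FPTComputable Γ g) : FPTComputable Γ fun a => if P a then f a else g a := by
  obtain ⟨u, hu, hP⟩ := hP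
  intro D hD
  obtain ⟨p, c, hc, H⟩ := hu D hD
  obtain ⟨p₁, c₁, hc₁, H₁⟩ := hf D hD
  obtain ⟨p₂, c₂, hc₂, H₂⟩ := hg D hD
  refine ⟨p.seq (.branch (.reg D) p₁ p₂), _, hc.add (FPTBounded.add (.const 2) (hc₁.add hc₂)),
    fun a s hs => (H a s hs).seq le_rfl fun s' hs' hv => ?_⟩
  have hok := Γ.ok_of_agreeBelow hs (hs'.mono hD)
  beta_reduce
  split_ifs with h
  · exact .branch_true (by simpa only [Expr.eval, hv] using (hP a).2 h)
      ((H₁ a s' hok).mono (Nat.le_add_right _ _))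
  · exact .branch_false (by simpa only [Expr.eval, hv] using not_not.1 (mt (hP a).1 h))
      ((H₂ a s' hok).mono (Nat.le_add_left _ _))

theorem fold (acc : α → ℕ → ℕ) (hb : LoopBound Γ b) (h0 : FPTComputable Γ fun a => acc a 0)
    (hstep : ∀ Γ' : Ctx enc par fun x : (a : α) × Fin (b a) => ι x.1, InLoop Γ' Γ →
      FPTComputable Γ' (fun x => acc x.1 x.2) → FPTComputable Γ' fun x => acc x.1 (x.2 + 1)) :
    FPTComputable Γ fun a => acc a (b a) := by
  intro D hD
  obtain ⟨pb, cb, hcb, Hb⟩ := hb.computable D hD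
  obtain ⟨p0, c0, hc0, H0⟩ := h0 (D + 1) (by omega)
  obtain ⟨p, c, ⟨F, q, hF, hc⟩, H⟩ := hstep (Γ.loopBody D b acc)
    ⟨le_max_left _ _, And.left, .of_reg (D + 2) fun _ _ h => h.2.2, (hb.bounded.comp Sigma.fst).mono
      fun x => x.2.isLt.le⟩ (.of_reg (D + 1) fun _ _ h => h.2.1) (D + 3) (max_le (by omega) le_rfl)
  refine ⟨pb.seq (p0.seq (.seq (.assign (D + 2) (.const 0)) ((p.countingLoop D).seq
    (.assign D (.reg (D + 1)))))), _, hcb.add (hc0.add (.add (.const 2) (.add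
      (.add (.mul hb.bounded (.add ⟨F, q, hF, fun _ => le_rfl⟩ (.const 10))) (.const 4))
      (.const 2)))), fun a s hs => ?_⟩
  refine (Hb a s hs).seq le_rfl fun s₁ h₁ hv₁ => ?_
  have hs₁ := Γ.ok_of_agreeBelow hs (h₁.mono hD)
  refine (H0 a s₁ hs₁).seq D.le_succ fun s₂ h₂ hv₂ => ?_
  refine Program.Yields.seq (by omega) (.assign _) fun s₃ h₃ hv₃ => ?_
  have h₁₃ := h₂.trans (h₃.mono D.succ.le_succ)
  have hs₃ := Γ.ok_of_agreeBelow hs₁ (h₁₃.mono (by omega))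
  refine Program.Yields.seq D.le_succ (.countingLoop (fun s' j hs' hj hacc hi => ?_)
    ((h₁₃.1 D (by omega)).trans hv₁) (zero_add _) ((h₃.1 _ (by omega)).trans hv₂) hv₃)
    fun s₄ _ hv₄ => ?_
  · exact (H ⟨a, j, hj⟩ s' ⟨Γ.ok_of_agreeBelow hs₃ (hs'.mono (by omega)), hacc, hi⟩).mono (hc _)
  · beta_reduce
    exact hv₄ ▸ .assign _

end FPTComputable

end RAM

theorem count_lt_of_le {m n : ℕ} (h : m ≤ n) : Nat.count (· < m) n = m := by
  obtain ⟨k, rfl⟩ := Nat.exists_eq_add_of_le h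
  simp [Nat.count_add, Nat.count_iff_forall.2]

theorem mod_eq_ite_mod_two_mul (x y : ℕ) :
    x % y = if y ≤ x % (2 * y) then x % (2 * y) - y else x % (2 * y) := by
  rw [mul_comm, Nat.mod_mul]
  rcases Nat.eq_zero_or_pos y with rfl | hy
  · simp
  have hlt := Nat.mod_lt x hy
  rcases Nat.mod_two_eq_zero_or_one (x / y) with h | h <;> rw [h] <;> split_ifs <;> omega

namespace RAM

variable {I : Type} {enc : I → List (Fin 3)} {par : I → ℕ} {α : Type} {ι : α → I}
  {Γ : Ctx enc par ι} {b f g : α → ℕ} {P Q : α → Prop}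
  {Γ' : Ctx enc par fun x : (a : α) × Fin (b a) => ι x.1}

namespace LoopBound

theorem of_paramBounded (hf : FPTComputable Γ f) (h : ParamBounded (fun a => par (ι a)) f) :
    LoopBound Γ f := ⟨hf, h.fptBounded⟩

theorem lift (hf : LoopBound Γ f) (E : InLoop Γ' Γ) : LoopBound Γ' fun x => f x.1 :=
  ⟨hf.computable.lift E, hf.bounded.comp Sigma.fst⟩

theorem const (k : ℕ) : LoopBound Γ fun _ => k := ⟨.const k, .const k⟩

theorem length : LoopBound Γ fun a => (enc (ι a)).length := ⟨.length, .length⟩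

theorem add (hf : LoopBound Γ f) (hg : LoopBound Γ g) : LoopBound Γ fun a => f a + g a :=
  ⟨hf.computable.add hg.computable, hf.bounded.add hg.bounded⟩

end LoopBound

namespace FPTDecidable

theorem congr (hP : FPTDecidable Γ P) (h : ∀ a, P a ↔ Q a) : FPTDecidable Γ Q :=
  (funext fun a => propext (h a) : P = Q) ▸ hP

theorem lt (hf : FPTComputable Γ f) (hg : FPTComputable Γ g) : FPTDecidable Γ fun a => f a < g a :=
  ⟨_, hg.sub hf, fun _ => Nat.sub_ne_zero_iff_lt⟩

theorem not (hP : FPTDecidable Γ P) : FPTDecidable Γ fun a => ¬ P a :=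
  let ⟨f, hf, hP⟩ := hP
  ⟨_, (FPTComputable.const 1).sub hf, fun a => by simp only [← hP a]; omega⟩

theorem le (hf : FPTComputable Γ f) (hg : FPTComputable Γ g) : FPTDecidable Γ fun a => f a ≤ g a :=
  (lt hg hf).not.congr fun _ => not_lt

theorem and (hP : FPTDecidable Γ P) (hQ : FPTDecidable Γ Q) : FPTDecidable Γ fun a => P a ∧ Q a :=
  let ⟨_, hf, hP⟩ := hP
  let ⟨_, hg, hQ⟩ := hQ
  ⟨_, hf.min hg, fun a => by simp only [← hP a, ← hQ a]; omega⟩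

theorem imp (hP : FPTDecidable Γ P) (hQ : FPTDecidable Γ Q) : FPTDecidable Γ fun a => P a → Q a :=
  (hP.and hQ.not).not.congr fun a => by tauto

theorem iff (hP : FPTDecidable Γ P) (hQ : FPTDecidable Γ Q) : FPTDecidable Γ fun a => P a ↔ Q a :=
  ((hP.imp hQ).and (hQ.imp hP)).congr fun _ => iff_iff_implies_and_implies.symm

theorem eq (hf : FPTComputable Γ f) (hg : FPTComputable Γ g) : FPTDecidable Γ fun a => f a = g a :=
  ((le hf hg).and (le hg hf)).congr fun _ => le_antisymm_iff.symm

end FPTDecidable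

namespace FPTComputable

theorem mul (hf : FPTComputable Γ f) (hg : LoopBound Γ g) : FPTComputable Γ fun a => f a * g a :=
  fold (fun a i => f a * i) hg (const 0) fun _ E hacc => hacc.add (hf.lift E)

theorem mul_two_pow (hf : FPTComputable Γ f) (hg : LoopBound Γ g) :
    FPTComputable Γ fun a => f a * 2 ^ g a :=
  fold (fun a i => f a * 2 ^ i) hg (by simpa using hf) fun _ _ hacc => by
    simpa only [pow_succ, mul_two, mul_add] using hacc.add hacc

theorem two_pow (hg : LoopBound Γ g) : FPTComputable Γ fun a => 2 ^ g a := by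
  simpa using mul_two_pow (const 1) hg

theorem div_two_pow (hf : FPTComputable Γ f) (hg : LoopBound Γ g) :
    FPTComputable Γ fun a => f a / 2 ^ g a :=
  fold (fun a i => f a / 2 ^ i) hg (by simpa using hf) fun _ _ hacc => by
    simpa only [pow_succ, ← Nat.div_div_eq_div_mul] using hacc.half

theorem count {A : α → ℕ → Prop} [∀ a, DecidablePred (A a)] (hb : LoopBound Γ b)
    (hA : ∀ Γ' : Ctx enc par fun x : (a : α) × Fin (b a) => ι x.1, InLoop Γ' Γ →
      FPTDecidable Γ' fun x => A x.1 x.2) :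
    FPTComputable Γ fun a => Nat.count (A a) (b a) := by
  refine fold (fun a i => Nat.count (A a) i) hb (by simpa using const 0) fun Γ' E hacc => ?_
  simp only [Nat.count_succ]
  exact hacc.add (ite (hA Γ' E) (const 1) (const 0))

theorem sup {F : α → ℕ → ℕ} (hb : LoopBound Γ b)
    (hF : ∀ Γ' : Ctx enc par fun x : (a : α) × Fin (b a) => ι x.1, InLoop Γ' Γ →
      FPTComputable Γ' fun x => F x.1 x.2) :
    FPTComputable Γ fun a => (Finset.range (b a)).sup (F a) :=
  fold (fun a i => (Finset.range i).sup (F a)) hb (const 0) fun Γ' E hacc => by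
    simpa only [Finset.range_add_one, Finset.sup_insert] using (hF Γ' E).max hacc

end FPTComputable

namespace LoopBound

theorem mul (hf : LoopBound Γ f) (hg : LoopBound Γ g) : LoopBound Γ fun a => f a * g a :=
  ⟨hf.computable.mul hg, hf.bounded.mul hg.bounded⟩

end LoopBound

namespace LogBounded

theorem lift (hf : LogBounded Γ f) (E : InLoop Γ' Γ) : LogBounded Γ' fun x => f x.1 :=
  let ⟨_, hb, h⟩ := hf
  ⟨_, hb.lift E, fun x => h x.1⟩

theorem mono (hf : LogBounded Γ f) (h : ∀ a, g a ≤ f a) : LogBounded Γ g :=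
  let ⟨_, hb, hf⟩ := hf
  ⟨_, hb, fun a => (h a).trans_lt (hf a)⟩

theorem of_loopBound (hf : LoopBound Γ f) : LogBounded Γ f :=
  ⟨_, hf, fun _ => Nat.lt_two_pow_self⟩

theorem two_pow (hf : LoopBound Γ f) : LogBounded Γ fun a => 2 ^ f a :=
  ⟨_, hf.add (.const 1), fun _ => Nat.pow_lt_pow_right one_lt_two (Nat.lt_succ_self _)⟩

theorem mul (hf : LogBounded Γ f) (hg : LogBounded Γ g) : LogBounded Γ fun a => f a * g a :=
  let ⟨_, hb, hf⟩ := hf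
  let ⟨_, hb', hg⟩ := hg
  ⟨_, hb.add hb', fun a => pow_add 2 _ _ ▸ Nat.mul_lt_mul'' (hf a) (hg a)⟩

theorem add (hf : LogBounded Γ f) (hg : LogBounded Γ g) : LogBounded Γ fun a => f a + g a := by
  obtain ⟨b, hb, hf⟩ := hf
  obtain ⟨b', hb', hg⟩ := hg
  refine ⟨_, (hb.add hb').add (.const 1), fun a => ?_⟩
  calc f a + g a < 2 ^ b a + 2 ^ b' a := Nat.add_lt_add (hf a) (hg a)
    _ ≤ 2 ^ (b a + b' a) + 2 ^ (b a + b' a) := by gcongr <;> omega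
    _ = 2 ^ (b a + b' a + 1) := by rw [pow_succ, mul_two]

end LogBounded

namespace FPTComputable

-- School division: reduce `f` modulo `g * 2 ^ b`, `g * 2 ^ (b - 1)`, …, `g`.
theorem mod (hf : FPTComputable Γ f) (hlog : LogBounded Γ f) (hg : FPTComputable Γ g) :
    FPTComputable Γ fun a => f a % g a := by
  obtain ⟨b, hb, hlt⟩ := hlog
  have h0 : ∀ a, f a % (g a * 2 ^ (b a - 0)) = f a := fun a => by
    rcases Nat.eq_zero_or_pos (g a) with h | h
    · simp [h]
    · exact Nat.mod_eq_of_lt ((hlt a).trans_le (Nat.le_mul_of_pos_left _ h))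
  have hfold := fold (fun a i => f a % (g a * 2 ^ (b a - i))) hb (by simpa only [h0] using hf)
    fun Γ' E hacc => ?_
  · simpa using hfold
  have hy : FPTComputable Γ' fun x => g x.1 * 2 ^ (b x.1 - (x.2 + 1)) :=
    (hg.lift E).mul_two_pow ⟨(hb.lift E).computable.sub (E.counter.computable.add (const 1)),
      (hb.lift E).bounded.mono fun x => Nat.sub_le _ _⟩
  refine cast (congrArg _ (funext fun x => ?_)) (ite (.le hy hacc) (hacc.sub hy) hacc)
  rw [show b x.1 - x.2 = b x.1 - (x.2 + 1) + 1 by omega, pow_succ', mul_left_comm,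
    ← mod_eq_ite_mod_two_mul]

theorem div (hf : LoopBound Γ f) (hg : FPTComputable Γ g) (hpos : ∀ a, 0 < g a) :
    FPTComputable Γ fun a => f a / g a := by
  have hcount : ∀ a, f a / g a = Nat.count (fun i => g a * (i + 1) ≤ f a) (f a) := fun a => by
    simp only [fun i => show g a * (i + 1) ≤ f a ↔ i < f a / g a by
      rw [Nat.lt_iff_add_one_le, Nat.le_div_iff_mul_le (hpos a), mul_comm]]
    exact (count_lt_of_le (Nat.div_le_self _ _)).symm
  simp only [hcount]
  exact count hf fun Γ' E =>
    .le ((hg.lift E).mul (E.counter.add (.const 1))) (hf.lift E).computable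

end FPTComputable

namespace FPTDecidable

theorem testBit (hf : FPTComputable Γ f) (hg : LoopBound Γ g) :
    FPTDecidable Γ fun a => (f a).testBit (g a) = true := by
  have h := hf.div_two_pow hg
  refine (eq (h.sub (h.half.add h.half)) (.const 1)).congr fun a => ?_
  rw [Nat.testBit_eq_decide_div_mod_eq, decide_eq_true_iff]
  omega

theorem exists_fin {R : ∀ a, Fin (b a) → Prop} (hb : LoopBound Γ b)
    (hR : ∀ Γ' : Ctx enc par fun x : (a : α) × Fin (b a) => ι x.1, InLoop Γ' Γ →
      FPTDecidable Γ' fun x => R x.1 x.2) :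
    FPTDecidable Γ fun a => ∃ i, R a i := by
  classical
  refine ⟨_, .count (A := fun a i => ∃ h : i < b a, R a ⟨i, h⟩) hb fun Γ' E =>
    (hR Γ' E).congr fun x => ⟨fun h => ⟨x.2.isLt, h⟩, fun h => h.2⟩, fun a => ?_⟩
  rw [Nat.count_ne_iff_exists]
  exact ⟨fun ⟨i, _, h, hi⟩ => ⟨⟨i, h⟩, hi⟩, fun ⟨i, hi⟩ => ⟨i, i.isLt, i.isLt, hi⟩⟩

theorem forall_fin {R : ∀ a, Fin (b a) → Prop} (hb : LoopBound Γ b)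
    (hR : ∀ Γ' : Ctx enc par fun x : (a : α) × Fin (b a) => ι x.1, InLoop Γ' Γ →
      FPTDecidable Γ' fun x => R x.1 x.2) :
    FPTDecidable Γ fun a => ∀ i, R a i :=
  (exists_fin (R := fun a i => ¬ R a i) hb fun Γ' E => (hR Γ' E).not).not.congr fun _ =>
    not_exists_not

end FPTDecidable

/-- The context at the start of the computation, where the inputs are indexed by themselves. -/
def Ctx.init (enc : I → List (Fin 3)) (par : I → ℕ) : Ctx enc par fun x => x where
  depth := 1
  ok x s := s.reg 0 = (enc x).length ∧ s.mem = letterAt (enc x)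
  ok_of_agreeBelow h h' := ⟨(h'.1 0 Nat.one_pos).trans h.1, h'.2.trans h.2⟩
  depth_pos := Nat.one_pos
  reg_zero h := h.1
  mem_eq h := h.2

end RAM

theorem ParamProblem.isFPT_of_fptDecidable {P : ParamProblem}
    (h : RAM.FPTDecidable (RAM.Ctx.init P.encode P.param) P.Yes) : P.IsFPT := by
  classical
  obtain ⟨p, c, ⟨f, q, hf, hc⟩, H⟩ := RAM.FPTComputable.ite h (.const 1) (.const 0) 1 le_rfl
  refine ⟨.seq p (.assign 0 (.reg 1)), fun k => f k + 2, q + 1,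
    Primrec.nat_add.to_comp.comp hf (Computable.const 2), fun x => ?_⟩
  obtain ⟨s, T, hr, hT, hs, -⟩ := H x (RAM.State.init (P.encode x)) ⟨rfl, rfl⟩
  refine ⟨_, _, .seq hr (.assign _ _ _), ?_, fun hY => ?_, fun hN => ?_⟩
  · calc T + (1 + 1) ≤ f (P.param x) * q.eval (P.encode x).length + 2 :=
          Nat.add_le_add_right (hT.trans (hc x)) 2
      _ ≤ (f (P.param x) + 2) * (q.eval (P.encode x).length + 1) := by nlinarith
      _ = (f (P.param x) + 2) * (q + 1).eval (P.encode x).length := by simp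
  · simp [RAM.Expr.eval, hs, hY]
  · simp [RAM.Expr.eval, hs, hN]

/-! ### Avoiding residue classes in an arithmetic progression -/

theorem sum_mul_pow_eq_zero_of_forall_lt_card {R σ : Type*} [CommRing R] (s : Finset σ)
    (c β : σ → R) (h : ∀ x < s.card, ∑ i ∈ s, c i * β i ^ x = 0) (x : ℕ) :
    ∑ i ∈ s, c i * β i ^ x = 0 := by
  classical
  induction s using Finset.induction_on generalizing c x with
  | empty => simp
  | insert a s ha ih =>
    have hrec : ∀ x, ∑ i ∈ s, c i * (β i - β a) * β i ^ x =
        ∑ i ∈ insert a s, c i * β i ^ (x + 1) - β a * ∑ i ∈ insert a s, c i * β i ^ x := fun x => by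
      rw [Finset.mul_sum, ← Finset.sum_sub_distrib, Finset.sum_insert ha]
      have : c a * β a ^ (x + 1) - β a * (c a * β a ^ x) = 0 := by ring
      rw [this, zero_add]
      exact Finset.sum_congr rfl fun i _ => by ring
    have hgeom : ∀ x, ∑ i ∈ insert a s, c i * β i ^ (x + 1) =
        β a * ∑ i ∈ insert a s, c i * β i ^ x := fun x => by
      rw [← sub_eq_zero, ← hrec]
      refine ih _ (fun y hy => ?_) x
      rw [Finset.card_insert_of_notMem ha] at h
      rw [hrec, h y (by omega), h (y + 1) (by omega), mul_zero, sub_zero]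
    induction x with
    | zero => exact h 0 (Finset.card_pos.2 (Finset.insert_nonempty a s))
    | succ x ihx => rw [hgeom, ihx, mul_zero]

theorem add_mul_modEq_iff_of_isPrimitiveRoot {R : Type*} [CommRing R] {ζ : R} {L : ℕ}
    (hζ : IsPrimitiveRoot ζ L) (hL : 0 < L) (r M p j : ℕ) :
    r + M * j ≡ p [MOD L] ↔ ζ ^ r * (ζ ^ M) ^ j + -ζ ^ p = 0 := by
  rw [← sub_eq_add_neg, sub_eq_zero, ← pow_mul, ← pow_add, hζ.eq_orderOf]
  exact (isOfFinOrder_iff_pow_eq_one.2 ⟨L, hL, hζ.pow_eq_one⟩).pow_eq_pow_iff_modEq.symm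

-- Multiplying the conditions `ζ ^ (r + M * j) ≠ ζ ^ p` for suitable roots of unity `ζ` gives an
-- exponential sum in `j` with `2 ^ s.card` terms.
theorem exists_lt_two_pow_not_modEq {σ : Type*} (s : Finset σ) (L p : σ → ℕ)
    (hL : ∀ i ∈ s, 0 < L i) (r M x : ℕ) (hx : ∀ i ∈ s, ¬ r + M * x ≡ p i [MOD L i]) :
    ∃ j < 2 ^ s.card, ∀ i ∈ s, ¬ r + M * j ≡ p i [MOD L i] := by
  classical
  let ζ : σ → ℂ := fun i => Complex.exp (2 * Real.pi * Complex.I / L i)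
  have hmodEq : ∀ i ∈ s, ∀ j, r + M * j ≡ p i [MOD L i] ↔
      ζ i ^ r * (ζ i ^ M) ^ j + -ζ i ^ p i = 0 := fun i hi =>
    add_mul_modEq_iff_of_isPrimitiveRoot (Complex.isPrimitiveRoot_exp _ (hL i hi).ne') (hL i hi)
      r M (p i)
  have hexp : ∀ j, ∏ i ∈ s, (ζ i ^ r * (ζ i ^ M) ^ j + -ζ i ^ p i) =
      ∑ t ∈ s.powerset, ((∏ i ∈ t, ζ i ^ r) * ∏ i ∈ s \ t, -ζ i ^ p i) *
        (∏ i ∈ t, ζ i ^ M) ^ j := fun j => by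
    rw [Finset.prod_add]
    refine Finset.sum_congr rfl fun t _ => ?_
    rw [Finset.prod_mul_distrib, Finset.prod_pow _ j, mul_right_comm]
  by_contra! hcon
  have hzero := sum_mul_pow_eq_zero_of_forall_lt_card s.powerset _ _
    (fun j hj => (hexp j).symm.trans ?_) x
  · obtain ⟨i, hi, h⟩ := Finset.prod_eq_zero_iff.1 ((hexp x).trans hzero)
    exact hx i hi ((hmodEq i hi x).2 h)
  · obtain ⟨i, hi, h⟩ := hcon j (hj.trans_eq (Finset.card_powerset s))
    exact Finset.prod_eq_zero hi ((hmodEq i hi j).1 h)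

/-! ### Simultaneous congruences -/

/-- The position of the `k`-th element of `A`, or `n` if there is no such element below `n`. -/
def nthBelow (A : ℕ → Prop) [DecidablePred A] (n k : ℕ) : ℕ :=
  Nat.count (fun i => Nat.count A (i + 1) ≤ k) n

section nthBelow

variable {A : ℕ → Prop} [DecidablePred A] {n i : ℕ}

theorem nthBelow_le (k : ℕ) : nthBelow A n k ≤ n := Nat.count_le _

theorem nthBelow_count (hi : i < n) (hA : A i) : nthBelow A n (Nat.count A i) = i := by
  have h : ∀ j, Nat.count A (j + 1) ≤ Nat.count A i ↔ j < i := fun j => by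
    refine ⟨fun hj => ?_, fun hj => Nat.count_monotone A hj⟩
    by_contra! hij
    exact (Nat.count_strict_mono hA (Nat.lt_succ_of_le hij)).not_ge hj
  simp only [nthBelow, h]
  exact count_lt_of_le hi.le

theorem nthBelow_zero_spec (hi : i < n) (hA : A i) : A (nthBelow A n 0) := by
  have hex : ∃ i, A i := ⟨i, hA⟩
  rw [← Nat.count_iff_forall_not.2 fun j hj => Nat.find_min hex hj,
    nthBelow_count ((Nat.find_le hA).trans_lt hi) (Nat.find_spec hex)]
  exact Nat.find_spec hex

end nthBelow

theorem exists_lt_add_mul_modEq {r t M Λ : ℕ} (hM : 0 < M) (hΛ : 0 < Λ) (h : t ≡ r [MOD M]) :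
    ∃ x < Λ, r + M * x ≡ t [MOD Λ] := by
  have hle : r ≤ t + r * (M * Λ) :=
    (Nat.le_mul_of_pos_right r (Nat.mul_pos hM hΛ)).trans (Nat.le_add_left _ _)
  have hr : r ≡ t + r * (M * Λ) [MOD M] := by
    simpa [Nat.ModEq, mul_left_comm r] using h.symm
  obtain ⟨x, hx⟩ := (Nat.modEq_iff_dvd' hle).1 hr
  refine ⟨x % Λ, Nat.mod_lt x hΛ, (((Nat.mod_modEq x Λ).mul_left M).add_left r).trans ?_⟩
  rw [← hx, Nat.add_sub_cancel' hle]
  simp [Nat.ModEq, ← mul_assoc]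

theorem lcm_eq_mul_div_sup (M L : ℕ) :
    M.lcm L = M * (L / max 1
      ((Finset.range (L + 1)).sup fun i => if M % i = 0 ∧ L % i = 0 then i else 0)) := by
  rcases Nat.eq_zero_or_pos L with rfl | hL
  · simp
  have hpos := Nat.gcd_pos_of_pos_right M hL
  have hsup : (Finset.range (L + 1)).sup (fun i => if M % i = 0 ∧ L % i = 0 then i else 0) =
      M.gcd L := by
    refine le_antisymm (Finset.sup_le fun i _ => ?_) ?_
    · split_ifs with h
      · exact Nat.le_of_dvd hpos
          (Nat.dvd_gcd (Nat.dvd_of_mod_eq_zero h.1) (Nat.dvd_of_mod_eq_zero h.2))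
      · exact Nat.zero_le _
    · refine le_of_eq_of_le (if_pos ⟨Nat.mod_eq_zero_of_dvd (Nat.gcd_dvd_left M L),
        Nat.mod_eq_zero_of_dvd (Nat.gcd_dvd_right M L)⟩).symm (Finset.le_sup (f := fun i =>
          if M % i = 0 ∧ L % i = 0 then i else 0) (Finset.mem_range.2 ?_))
      exact Nat.lt_succ_of_le (Nat.gcd_le_right M hL)
  rw [hsup, max_eq_right hpos, ← Nat.mul_div_assoc _ (Nat.gcd_dvd_right M L)]
  rfl

theorem lcm_range_succ (L : ℕ → ℕ) (k : ℕ) :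
    (Finset.range (k + 1)).lcm L = Nat.lcm ((Finset.range k).lcm L) (L k) := by
  rw [Finset.range_add_one, Finset.lcm_insert, lcm_comm]
  rfl

/-- A solution of the simultaneous congruences `t ≡ p e [MOD L e]` for `e < k`, if there is one. -/
def residue (L p : ℕ → ℕ) : ℕ → ℕ
  | 0 => 0
  | k + 1 => residue L p k + (Finset.range k).lcm L *
      nthBelow (fun i => residue L p k + (Finset.range k).lcm L * i ≡ p k [MOD L k]) (L k) 0

section residue

variable {L p : ℕ → ℕ} {t N : ℕ}

theorem lcm_range_pos (hL : ∀ e, 0 < L e) (k : ℕ) : 0 < (Finset.range k).lcm L :=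
  Nat.pos_of_ne_zero (Finset.lcm_ne_zero_iff.2 fun e _ => (hL e).ne')

theorem modEq_residue (hL : ∀ e, 0 < L e) {k : ℕ} (ht : ∀ e < k, t ≡ p e [MOD L e]) :
    t ≡ residue L p k [MOD (Finset.range k).lcm L] := by
  induction k with
  | zero => exact Nat.modEq_one
  | succ k ih =>
    have hk := ih fun e he => ht e (he.trans k.lt_succ_self)
    obtain ⟨x, hx, hxt⟩ := exists_lt_add_mul_modEq (lcm_range_pos hL k) (hL k) hk
    rw [lcm_range_succ]
    refine Nat.mod_lcm (hk.trans (by simp [residue, Nat.ModEq])) ((ht k k.lt_succ_self).trans ?_)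
    exact (nthBelow_zero_spec (A := fun i => residue L p k + (Finset.range k).lcm L * i ≡ p k
      [MOD L k]) hx (hxt.trans (ht k k.lt_succ_self))).symm

theorem lcm_range_le_two_pow (hN : ∀ e, L e ≤ N) (k : ℕ) :
    (Finset.range k).lcm L ≤ 2 ^ (N * k) := by
  induction k with
  | zero => simp
  | succ k ih =>
    rw [lcm_range_succ, Nat.mul_succ, pow_add]
    exact (Nat.div_le_self _ _).trans
      (Nat.mul_le_mul ih ((hN k).trans Nat.lt_two_pow_self.le))

theorem residue_lt_two_pow (hN : ∀ e, L e ≤ N) (k : ℕ) : residue L p k < 2 ^ (N * k) := by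
  induction k with
  | zero => simp [residue]
  | succ k ih =>
    calc residue L p (k + 1) < 2 ^ (N * k) + 2 ^ (N * k) * N :=
          Nat.add_lt_add_of_lt_of_le ih (Nat.mul_le_mul (lcm_range_le_two_pow hN k)
            ((nthBelow_le 0).trans (hN k)))
      _ = 2 ^ (N * k) * (N + 1) := by ring
      _ ≤ 2 ^ (N * k) * 2 ^ N := Nat.mul_le_mul_left _ Nat.lt_two_pow_self
      _ = 2 ^ (N * (k + 1)) := by rw [← pow_add, Nat.mul_succ]

theorem exists_modEq_iff (hL : ∀ e, 0 < L e) (t K : ℕ) {sel : ℕ → Prop} [DecidablePred sel]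
    (hsel : ∀ e < K, sel e ↔ t ≡ p e [MOD L e]) :
    ∃ j < 2 ^ K, ∀ e < K, residue (fun e => if sel e then L e else 1) p K +
        (Finset.range K).lcm (fun e => if sel e then L e else 1) * j ≡ p e [MOD L e] ↔
      t ≡ p e [MOD L e] := by
  set L' : ℕ → ℕ := fun e => if sel e then L e else 1 with hL'
  have hpos : ∀ e, 0 < L' e := fun e => by
    simp only [hL']
    split_ifs
    exacts [hL e, Nat.one_pos]
  have ht : t ≡ residue L' p K [MOD (Finset.range K).lcm L'] := modEq_residue hpos fun e he => by
    simp only [hL']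
    split_ifs with h
    exacts [(hsel e he).1 h, Nat.modEq_one]
  obtain ⟨x, -, hx⟩ := exists_lt_add_mul_modEq (lcm_range_pos hpos K) (lcm_range_pos hL K) ht
  let U := (Finset.range K).filter fun e => ¬ sel e
  have hU : ∀ e ∈ U, e < K ∧ ¬ sel e := fun e he => by simpa [U] using he
  obtain ⟨j, hj, havoid⟩ := exists_lt_two_pow_not_modEq U L p (fun e _ => hL e) _ _ x
    fun e he h => (hU e he).2 <| (hsel e (hU e he).1).2 <|
      (hx.of_dvd (Finset.dvd_lcm (Finset.mem_range.2 (hU e he).1))).symm.trans h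
  refine ⟨j, hj.trans_le (Nat.pow_le_pow_right two_pos ?_), fun e he => ?_⟩
  · exact (Finset.card_filter_le _ _).trans (Finset.card_range K).le
  · by_cases h : sel e
    · have hdvd : L e ∣ (Finset.range K).lcm L' := by
        simpa [hL', h] using Finset.dvd_lcm (f := L') (Finset.mem_range.2 he)
      refine iff_of_true (.trans ?_ ((hsel e he).1 h)) ((hsel e he).1 h)
      exact .trans (by simp [Nat.ModEq, Nat.add_mod, Nat.mul_mod, Nat.mod_eq_zero_of_dvd hdvd])
        (ht.of_dvd hdvd).symm
    · refine iff_of_false (havoid e ?_) fun h' => h ((hsel e he).2 h')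
      exact Finset.mem_filter.2 ⟨Finset.mem_range.2 he, h⟩

end residue

namespace RAM

variable {I : Type} {enc : I → List (Fin 3)} {par : I → ℕ} {α : Type} {ι : α → I}
  {Γ : Ctx enc par ι} {b f g N : α → ℕ} {L p : α → ℕ → ℕ}

theorem FPTDecidable.modEq (hf : FPTComputable Γ f) (hlog : LogBounded Γ f)
    {h : α → ℕ} (hh : FPTComputable Γ h) (hlog' : LogBounded Γ h) (hg : FPTComputable Γ g) :
    FPTDecidable Γ fun a => f a ≡ h a [MOD g a] :=
  .eq (hf.mod hlog hg) (hh.mod hlog' hg)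

theorem FPTComputable.nthBelow {n k : α → ℕ} {A : α → ℕ → Prop} [∀ a, DecidablePred (A a)]
    (hn : LoopBound Γ n) (hk : FPTComputable Γ k)
    (hA : ∀ Γ' : Ctx enc par fun x : (a : α) × Fin (n a) => ι x.1, InLoop Γ' Γ →
      ∀ Γ'' : Ctx enc par fun y : (x : (a : α) × Fin (n a)) × Fin (x.2 + 1) => ι y.1.1,
        InLoop Γ'' Γ' → FPTDecidable Γ'' fun y => A y.1.1 y.2) :
    FPTComputable Γ fun a => nthBelow (A a) (n a) (k a) :=
  count hn fun Γ' E => .le (count (E.counter.add (.const 1)) (hA Γ' E)) (hk.lift E)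

theorem LogBounded.lcm_range (hb : LoopBound Γ b) (hN : LoopBound Γ N)
    (hL : ∀ a e, L a e ≤ N a) : LogBounded Γ fun a => (Finset.range (b a)).lcm (L a) :=
  .mono (.two_pow (hN.mul hb)) fun a => lcm_range_le_two_pow (hL a) (b a)

theorem LogBounded.residue (hb : LoopBound Γ b) (hN : LoopBound Γ N)
    (hL : ∀ a e, L a e ≤ N a) : LogBounded Γ fun a => residue (L a) (p a) (b a) :=
  ⟨_, hN.mul hb, fun a => residue_lt_two_pow (hL a) (b a)⟩

namespace FPTComputable

theorem lcm (hf : FPTComputable Γ f) (hlog : LogBounded Γ f) (hg : LoopBound Γ g) :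
    FPTComputable Γ fun a => (f a).lcm (g a) := by
  simp only [lcm_eq_mul_div_sup]
  refine hf.mul ⟨.div hg (.max (.const 1) (.sup (hg.add (.const 1)) fun Γ' E => ?_))
    fun a => lt_max_of_lt_left Nat.one_pos, hg.bounded.mono fun a => Nat.div_le_self _ _⟩
  exact .ite (.and (.eq (.mod (hf.lift E) (hlog.lift E) E.counter.computable) (.const 0))
    (.eq (.mod (hg.lift E).computable (.of_loopBound (hg.lift E)) E.counter.computable) (.const 0)))
      E.counter.computable (.const 0)

theorem lcm_range (hb : LoopBound Γ b) (hN : LoopBound Γ N) (hL : ∀ a e, L a e ≤ N a)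
    (hcomp : ∀ Γ' : Ctx enc par fun x : (a : α) × Fin (b a) => ι x.1, InLoop Γ' Γ →
      FPTComputable Γ' fun x => L x.1 x.2) :
    FPTComputable Γ fun a => (Finset.range (b a)).lcm (L a) := by
  refine fold (fun a i => (Finset.range i).lcm (L a)) hb (const 1) fun Γ' E hacc => ?_
  simp only [lcm_range_succ]
  exact hacc.lcm (.lcm_range E.counter (hN.lift E) fun x => hL x.1)
    ⟨hcomp Γ' E, (hN.lift E).bounded.mono fun x => hL x.1 x.2⟩

theorem residue (hb : LoopBound Γ b) (hN : LoopBound Γ N) (hL : ∀ a e, L a e ≤ N a)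
    (hcomp : ∀ Γ' : Ctx enc par fun x : (a : α) × Fin (b a) => ι x.1, InLoop Γ' Γ →
      FPTComputable Γ' (fun x => L x.1 x.2) ∧ LoopBound Γ' (fun x => p x.1 x.2) ∧
        FPTComputable Γ' fun x => (Finset.range x.2).lcm (L x.1)) :
    FPTComputable Γ fun a => residue (L a) (p a) (b a) := by
  refine fold (fun a i => _root_.residue (L a) (p a) i) hb (const 0) fun Γ' E hacc => ?_
  obtain ⟨hLx, hp, hM⟩ := hcomp Γ' E
  have hLb : LoopBound Γ' fun x => L x.1 x.2 :=
    ⟨hLx, (hN.lift E).bounded.mono fun x => hL x.1 x.2⟩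
  have hM_log : LogBounded Γ' fun x => (Finset.range x.2).lcm (L x.1) :=
    .lcm_range E.counter (hN.lift E) fun x => hL x.1
  have hacc_log : LogBounded Γ' fun x => _root_.residue (L x.1) (p x.1) x.2 :=
    .residue E.counter (hN.lift E) fun x => hL x.1
  simp only [_root_.residue]
  refine hacc.add (hM.mul ⟨.nthBelow hLb (const 0) fun Γ₁ E₁ Γ₂ E₂ => ?_,
    hLb.bounded.mono fun x => nthBelow_le 0⟩)
  exact .modEq (((hacc.lift E₁).lift E₂).add (((hM.lift E₁).lift E₂).mul E₂.counter))
    (((hacc_log.lift E₁).lift E₂).add (((hM_log.lift E₁).lift E₂).mul (.of_loopBound E₂.counter)))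
    ((hp.lift E₁).lift E₂).computable (.of_loopBound ((hp.lift E₁).lift E₂))
    ((hLx.lift E₁).lift E₂)

end FPTComputable

end RAM

/-! ### Branch sets -/

section Minors

variable {U V W : Type} {F : SimpleGraph U} {G : SimpleGraph V} {H : SimpleGraph W}
  {R : W → V → Prop}

/-- The branch sets `{v | R h v}`, for the vertices `h` of `H`, exhibit `H` as a minor of `G`: they
are nonempty, disjoint and connected, and adjacent vertices have adjacent branch sets. Connectedness
is expressed by cuts, which makes it a search over vertex sets. -/
structure IsMinorModel (H : SimpleGraph W) (G : SimpleGraph V) (R : W → V → Prop) : Prop where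
  nonempty : ∀ h, ∃ v, R h v
  disjoint : ∀ h h' v, R h v → R h' v → h = h'
  connected : ∀ h (S : V → Prop), (∃ v, R h v ∧ S v) → (∃ v, R h v ∧ ¬ S v) →
    ∃ v v', R h v ∧ R h v' ∧ S v ∧ ¬ S v' ∧ G.Adj v v'
  adj : ∀ h h', H.Adj h h' → ∃ v v', R h v ∧ R h' v' ∧ G.Adj v v'

namespace IsMinorModel

theorem refl (H : SimpleGraph W) : IsMinorModel H H Eq where
  nonempty h := ⟨h, rfl⟩
  disjoint := by rintro h h' v rfl rfl; rfl
  connected := by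
    rintro h S ⟨_, rfl, hS⟩ ⟨_, rfl, hS'⟩
    exact absurd hS hS'
  adj h h' hadj := ⟨h, h', rfl, rfl, hadj⟩

theorem map (hR : IsMinorModel H G R) (f : V → U)
    (hadj : ∀ x y, G.Adj x y → f x ≠ f y → F.Adj (f x) (f y))
    (hf : ∀ h h' x y, R h x → R h' y → f x = f y → h = h') :
    IsMinorModel H F fun h u => ∃ v, R h v ∧ f v = u where
  nonempty h := by
    obtain ⟨v, hv⟩ := hR.nonempty h
    exact ⟨f v, v, hv, rfl⟩
  disjoint := by
    rintro h h' _ ⟨x, hx, rfl⟩ ⟨y, hy, hxy⟩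
    exact hf h h' x y hx hy hxy.symm
  connected := by
    rintro h S ⟨_, ⟨x, hx, rfl⟩, hSx⟩ ⟨_, ⟨y, hy, rfl⟩, hSy⟩
    obtain ⟨a, b, ha, hb, hSa, hSb, hab⟩ :=
      hR.connected h (fun v => S (f v)) ⟨x, hx, hSx⟩ ⟨y, hy, hSy⟩
    exact ⟨f a, f b, ⟨a, ha, rfl⟩, ⟨b, hb, rfl⟩, hSa, hSb, hadj a b hab fun e => hSb (e ▸ hSa)⟩
  adj h h' hh' := by
    obtain ⟨x, y, hx, hy, hxy⟩ := hR.adj h h' hh'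
    exact ⟨f x, f y, ⟨x, hx, rfl⟩, ⟨y, hy, rfl⟩,
      hadj x y hxy fun e => hh'.ne (hf h h' x y hx hy e)⟩

theorem map_hom (hR : IsMinorModel H G R) (φ : G →g F) (hφ : Function.Injective φ) :
    IsMinorModel H F fun h u => ∃ v, R h v ∧ φ v = u :=
  hR.map φ (fun _ _ hxy _ => φ.map_adj hxy) fun h h' x _ hx hy e =>
    hR.disjoint h h' x hx (hφ e ▸ hy)

theorem comap_embedding (hR : IsMinorModel H G R) (φ : F ↪g G)
    (hφ : ∀ h v, R h v → v ∈ Set.range φ) : IsMinorModel H F fun h u => R h (φ u) where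
  nonempty h := by
    obtain ⟨v, hv⟩ := hR.nonempty h
    obtain ⟨u, rfl⟩ := hφ h v hv
    exact ⟨u, hv⟩
  disjoint h h' u := hR.disjoint h h' (φ u)
  connected := by
    rintro h S ⟨x, hx, hSx⟩ ⟨y, hy, hSy⟩
    obtain ⟨_, b, ha, hb, ⟨a, hSa, rfl⟩, hSb, hab⟩ := hR.connected h (fun v => ∃ u, S u ∧ φ u = v)
      ⟨_, hx, x, hSx, rfl⟩ ⟨_, hy, fun ⟨z, hSz, e⟩ => hSy (φ.injective e ▸ hSz)⟩
    obtain ⟨b, rfl⟩ := hφ h b hb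
    exact ⟨a, b, ha, hb, hSa, fun hS => hSb ⟨b, hS, rfl⟩, φ.map_adj_iff.1 hab⟩
  adj h h' hh' := by
    obtain ⟨x, y, hx, hy, hxy⟩ := hR.adj h h' hh'
    obtain ⟨⟨x, rfl⟩, y, rfl⟩ := And.intro (hφ h x hx) (hφ h' y hy)
    exact ⟨x, y, hx, hy, φ.map_adj_iff.1 hxy⟩

theorem comap_of_connected_fibers (hR : IsMinorModel H G R) (f : U → V) (hf : Function.Surjective f)
    (hadj : ∀ v v', G.Adj v v' → ∃ x y, f x = v ∧ f y = v' ∧ F.Adj x y)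
    (hconn : ∀ (S : U → Prop) x y, f x = f y → S x → ¬ S y →
      ∃ a b, f a = f x ∧ f b = f x ∧ S a ∧ ¬ S b ∧ F.Adj a b) :
    IsMinorModel H F fun h u => R h (f u) where
  nonempty h := by
    obtain ⟨v, hv⟩ := hR.nonempty h
    obtain ⟨u, rfl⟩ := hf v
    exact ⟨u, hv⟩
  disjoint h h' u := hR.disjoint h h' (f u)
  connected := by
    rintro h S ⟨x, hx, hSx⟩ ⟨y, hy, hSy⟩
    -- Either `S` separates a fibre inside the branch set, or it is a union of fibres there.
    by_cases hsep : ∃ x y, R h (f x) ∧ f x = f y ∧ S x ∧ ¬ S y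
    · obtain ⟨x, y, hx, hxy, hSx, hSy⟩ := hsep
      obtain ⟨a, b, ha, hb, hab⟩ := hconn S x y hxy hSx hSy
      exact ⟨a, b, by rwa [ha], by rwa [hb], hab⟩
    push Not at hsep
    obtain ⟨v, v', hv, hv', ⟨c, rfl, hSc⟩, hSv', hvv'⟩ := hR.connected h
      (fun v => ∃ x, f x = v ∧ S x) ⟨f x, hx, x, rfl, hSx⟩
      ⟨f y, hy, fun ⟨z, hz, hSz⟩ => hSy (hsep z y (by rwa [hz]) hz hSz)⟩
    obtain ⟨a, b, ha, rfl, hab⟩ := hadj _ _ hvv'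
    exact ⟨a, b, by rwa [ha], hv', hsep c a hv ha.symm hSc, fun hSb => hSv' ⟨b, rfl, hSb⟩, hab⟩
  adj h h' hh' := by
    obtain ⟨v, v', hv, hv', hvv'⟩ := hR.adj h h' hh'
    obtain ⟨x, y, rfl, rfl, hxy⟩ := hadj v v' hvv'
    exact ⟨x, y, hv, hv', hxy⟩

end IsMinorModel

open Classical in
/-- The vertex map of the contraction of the edge `uv`: it sends `v` to `u` and fixes all other
vertices. -/
noncomputable def contractMap {u v : V} (huv : u ≠ v) (x : V) : {x : V // x ≠ v} :=
  if hx : x = v then ⟨u, huv⟩ else ⟨x, hx⟩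

theorem contractMap_right {u v : V} (huv : u ≠ v) : contractMap huv v = ⟨u, huv⟩ :=
  dif_pos rfl

theorem contractMap_of_ne {u v x : V} (huv : u ≠ v) (hx : x ≠ v) : contractMap huv x = ⟨x, hx⟩ :=
  dif_neg hx

theorem contractMap_eq_contractMap {u v x y : V} (huv : u ≠ v)
    (h : contractMap huv x = contractMap huv y) :
    x = y ∨ (x = v ∧ y = u) ∨ (x = u ∧ y = v) := by
  unfold contractMap at h
  split_ifs at h with hx hy hy <;> simp_all

theorem contractEdge_adj_contractMap {u v x y : V} (huv : u ≠ v) (hxy : G.Adj x y)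
    (hne : contractMap huv x ≠ contractMap huv y) :
    (G.contractEdge u v).Adj (contractMap huv x) (contractMap huv y) := by
  refine ⟨hne, ?_⟩
  by_cases hx : x = v
  · subst hx
    rw [contractMap_right, contractMap_of_ne huv hxy.ne']
    exact .inr (.inl ⟨rfl, hxy⟩)
  by_cases hy : y = v
  · subst hy
    rw [contractMap_right, contractMap_of_ne huv hx]
    exact .inr (.inr ⟨rfl, hxy.symm⟩)
  rw [contractMap_of_ne huv hx, contractMap_of_ne huv hy]
  exact .inl hxy

theorem exists_adj_of_contractEdge_adj {u v : V} (huv : u ≠ v) {x y : {x : V // x ≠ v}}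
    (hxy : (G.contractEdge u v).Adj x y) :
    ∃ a b, contractMap huv a = x ∧ contractMap huv b = y ∧ G.Adj a b := by
  have hfix (z : {x : V // x ≠ v}) : contractMap huv z = z := contractMap_of_ne huv z.2
  have hv {z : {x : V // x ≠ v}} (hz : (z : V) = u) : contractMap huv v = z :=
    (contractMap_right huv).trans (Subtype.ext hz.symm)
  obtain ⟨-, h | ⟨hx, h⟩ | ⟨hy, h⟩⟩ := hxy
  · exact ⟨x, y, hfix x, hfix y, h⟩
  · exact ⟨v, y, hv hx, hfix y, h⟩
  · exact ⟨x, v, hfix x, hv hy, h.symm⟩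

theorem IsMinorModel.of_contractEdge {u v : V} {R : W → {x : V // x ≠ v} → Prop} (huv : G.Adj u v)
    (hR : IsMinorModel H (G.contractEdge u v) R) :
    IsMinorModel H G fun h x => R h (contractMap huv.ne x) := by
  refine hR.comap_of_connected_fibers (contractMap huv.ne)
    (fun x => ⟨x, contractMap_of_ne _ x.2⟩) (fun x y => exists_adj_of_contractEdge_adj huv.ne)
    fun S x y hxy hSx hSy => ?_
  rcases contractMap_eq_contractMap huv.ne hxy with rfl | ⟨rfl, rfl⟩ | ⟨rfl, rfl⟩
  · exact absurd hSx hSy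
  · exact ⟨x, y, rfl, hxy.symm, hSx, hSy, huv.symm⟩
  · exact ⟨x, y, rfl, hxy.symm, hSx, hSy, huv⟩

theorem IsMinorModel.contractEdge {u v : V} {h₀ : W} (hR : IsMinorModel H G R) (huv : u ≠ v)
    (hu : R h₀ u) (hv : R h₀ v) :
    IsMinorModel H (G.contractEdge u v) fun h x => ∃ y, R h y ∧ contractMap huv y = x := by
  refine hR.map (contractMap huv) (fun x y => contractEdge_adj_contractMap huv)
    fun h h' x y hx hy hxy => ?_
  rcases contractMap_eq_contractMap huv hxy with rfl | ⟨rfl, rfl⟩ | ⟨rfl, rfl⟩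
  · exact hR.disjoint h h' x hx hy
  · exact (hR.disjoint h h₀ x hx hv).trans (hR.disjoint h₀ h' y hu hy)
  · exact (hR.disjoint h h₀ x hx hu).trans (hR.disjoint h₀ h' y hv hy)

theorem exists_isMinorModel_of_isMinorOf (h : H.IsMinorOf G) : ∃ R, IsMinorModel H G R := by
  induction h with
  | iso h =>
    obtain ⟨φ⟩ := h
    exact ⟨_, (IsMinorModel.refl H).map_hom φ.toHom φ.injective⟩
  | deleteVertex v _ ih =>
    obtain ⟨R, hR⟩ := ih
    exact ⟨_, hR.map_hom (SimpleGraph.Embedding.induce _).toHom Subtype.val_injective⟩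
  | deleteEdge e _ _ ih =>
    obtain ⟨R, hR⟩ := ih
    exact ⟨_, hR.map_hom (.ofLE (SimpleGraph.deleteEdges_le _)) Function.injective_id⟩
  | contract u v huv _ ih =>
    obtain ⟨R, hR⟩ := ih
    exact ⟨_, hR.of_contractEdge huv⟩

theorem isMinorOf_of_equiv [Finite V] (φ : W ≃ V) (hφ : ∀ h h', H.Adj h h' → G.Adj (φ h) (φ h')) :
    H.IsMinorOf G := by
  induction hn : G.edgeSet.ncard using Nat.strong_induction_on generalizing G with
  | _ n ih =>
    by_cases hiso : ∀ h h', G.Adj (φ h) (φ h') → H.Adj h h'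
    · exact .iso ⟨⟨φ, fun {h h'} => ⟨hiso h h', hφ h h'⟩⟩⟩
    push Not at hiso
    obtain ⟨h, h', hG, hH⟩ := hiso
    have he : s(φ h, φ h') ∈ G.edgeSet := hG
    refine .deleteEdge _ he (ih _ ?_ (fun a a' hadj => ?_) rfl)
    · rw [← hn, SimpleGraph.edgeSet_deleteEdges]
      exact Set.ncard_lt_ncard ⟨Set.sdiff_subset, fun hle => (hle he).2 rfl⟩ (Set.toFinite _)
    · refine SimpleGraph.deleteEdges_adj.2 ⟨hφ a a' hadj, fun hmem => hH ?_⟩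
      rw [Set.mem_singleton_iff, Sym2.eq_iff] at hmem
      rcases hmem with ⟨h₁, h₂⟩ | ⟨h₁, h₂⟩
      · rwa [← φ.injective h₁, ← φ.injective h₂]
      · rw [← φ.injective h₁, ← φ.injective h₂]
        exact hadj.symm

theorem IsMinorModel.isMinorOf_of_singletons [Finite V] (hR : IsMinorModel H G R)
    (hcover : ∀ v, ∃ h, R h v) (hsub : ∀ h x y, R h x → R h y → x = y) : H.IsMinorOf G := by
  choose φ hφ using hR.nonempty
  have hbij : Function.Bijective φ := by
    refine ⟨fun h h' e => hR.disjoint h h' (φ h) (hφ h) (e ▸ hφ h'), fun v => ?_⟩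
    obtain ⟨h, hh⟩ := hcover v
    exact ⟨h, hsub h _ _ (hφ h) hh⟩
  refine isMinorOf_of_equiv (Equiv.ofBijective φ hbij) fun h h' hadj => ?_
  obtain ⟨x, y, hx, hy, hxy⟩ := hR.adj h h' hadj
  rwa [← hsub h _ _ (hφ h) hx, ← hsub h' _ _ (hφ h') hy] at hxy

theorem IsMinorModel.isMinorOf [Finite V] (hR : IsMinorModel H G R) : H.IsMinorOf G := by
  induction hn : Nat.card V using Nat.strong_induction_on generalizing V with
  | _ n ih =>
    have hcard (v : V) : Nat.card {x : V // x ≠ v} < n :=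
      hn ▸ Finite.card_subtype_lt (x := v) (by simp)
    by_cases hcover : ∀ v, ∃ h, R h v
    · by_cases hsub : ∀ h x y, R h x → R h y → x = y
      · exact hR.isMinorOf_of_singletons hcover hsub
      push Not at hsub
      obtain ⟨h, x, y, hx, hy, hxy⟩ := hsub
      obtain ⟨u, v, hu, hv, -, -, huv⟩ := hR.connected h (· = x) ⟨x, hx, rfl⟩ ⟨y, hy, hxy.symm⟩
      exact .contract u v huv (ih _ (hcard v) (hR.contractEdge huv.ne hu hv) rfl)
    · push Not at hcover
      obtain ⟨v, hv⟩ := hcover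
      exact .deleteVertex v (ih _ (hcard v) (hR.comap_embedding (SimpleGraph.Embedding.induce _)
        fun h x hx => ⟨⟨x, fun e => hv h (e ▸ hx)⟩, rfl⟩) rfl)

theorem isMinorOf_iff_exists_isMinorModel [Finite V] :
    H.IsMinorOf G ↔ ∃ R, IsMinorModel H G R :=
  ⟨exists_isMinorModel_of_isMinorOf, fun ⟨_, hR⟩ => hR.isMinorOf⟩

/-- The relation `R` exhibits `H` as an induced subgraph of `G`: every map `φ` with `R h (φ h)` for
all `h` is an embedding. -/
structure IsInducedCopy (H : SimpleGraph W) (G : SimpleGraph V) (R : W → V → Prop) : Prop where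
  nonempty : ∀ h, ∃ v, R h v
  disjoint : ∀ h h' v, R h v → R h' v → h = h'
  adj_iff : ∀ h h' v v', R h v → R h' v' → (H.Adj h h' ↔ G.Adj v v')

theorem isIndContained_iff_exists_isInducedCopy :
    H.IsIndContained G ↔ ∃ R, IsInducedCopy H G R := by
  constructor
  · rintro ⟨φ⟩
    refine ⟨fun h v => φ h = v, fun h => ⟨φ h, rfl⟩, ?_, ?_⟩
    · rintro h h' _ rfl e
      exact φ.injective e.symm
    · rintro h h' _ _ rfl rfl
      exact φ.map_adj_iff.symm
  · rintro ⟨R, hR⟩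
    choose φ hφ using hR.nonempty
    exact ⟨⟨⟨φ, fun h h' e => hR.disjoint h h' (φ h) (hφ h) (e ▸ hφ h')⟩,
      fun {h h'} => (hR.adj_iff h h' _ _ (hφ h) (hφ h')).symm⟩⟩

theorem card_le_of_disjoint_nonempty [Fintype V] [Fintype W] (hne : ∀ h, ∃ v, R h v)
    (hdisj : ∀ h h' v, R h v → R h' v → h = h') : Fintype.card W ≤ Fintype.card V := by
  choose φ hφ using hne
  exact Fintype.card_le_of_injective φ fun h h' e => hdisj h h' (φ h) (hφ h) (e ▸ hφ h')

end Minors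

/-! ### Decoding an instance -/

theorem count_congr_of_lt {A B : ℕ → Prop} [DecidablePred A] [DecidablePred B] {n : ℕ}
    (h : ∀ i < n, (A i ↔ B i)) : Nat.count A n = Nat.count B n := by
  rw [Nat.count_eq_card_filter_range, Nat.count_eq_card_filter_range,
    Finset.filter_congr fun i hi => h i (Finset.mem_range.1 hi)]

theorem flatMap_finRange_eq_ofFn {β : Type*} {n : ℕ} (f : Fin n → Fin n → β) :
    ((List.finRange n).flatMap fun u => (List.finRange n).map fun v => f u v) =
      List.ofFn fun q => f (finProdFinEquiv.symm q).1 (finProdFinEquiv.symm q).2 := by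
  have hsymm (u v : Fin n) (h : (u : ℕ) * n + v < n * n) :
      finProdFinEquiv.symm ⟨(u : ℕ) * n + v, h⟩ = (u, v) := by
    rw [Equiv.symm_apply_eq, Fin.ext_iff, finProdFinEquiv_apply_val]
    ring
  rw [List.ofFn_mul, List.flatMap_def, List.ofFn_eq_map]
  simp only [List.ofFn_eq_map, hsymm]

namespace RAM

section letterAt

variable {A B : List (Fin 3)} {i : ℕ}

theorem letterAt_append_left (h : i < A.length) : letterAt (A ++ B) i = letterAt A i := by
  rw [letterAt, letterAt, List.getElem?_append_left h]

theorem letterAt_append_right (A B : List (Fin 3)) (i : ℕ) :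
    letterAt (A ++ B) (A.length + i) = letterAt B i := by
  simp [letterAt, List.getElem?_append_right]

theorem letterAt_eq_getElem (h : i < A.length) : letterAt A i = A[i] := by
  simp [letterAt, List.getElem?_eq_getElem h]

theorem count_letterAt (A : List (Fin 3)) (c : Fin 3) :
    Nat.count (fun i => letterAt A i = c) A.length = A.count c := by
  induction A using List.reverseRecOn with
  | nil => simp
  | append_singleton A a ih =>
    have hlast : letterAt (A ++ [a]) A.length = a := by simp [letterAt]
    rw [List.length_append, List.length_singleton, Nat.count_succ, List.count_append, hlast,
      count_congr_of_lt (B := fun i => letterAt A i = c)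
        fun i hi => by rw [letterAt_append_left hi], ih]
    simp [Fin.ext_iff, List.count_singleton]

end letterAt

/-- The concatenation of words, each terminated by the letter `2`. -/
def joinWords (ws : List (List (Fin 3))) : List (Fin 3) := ws.flatMap (· ++ [2])

/-- The position of the `k`-th separator `2`. -/
def sepPos (E : List (Fin 3)) (k : ℕ) : ℕ := nthBelow (fun i => letterAt E i = 2) E.length k

theorem sepPos_append_cons (A B : List (Fin 3)) : sepPos (A ++ 2 :: B) (A.count 2) = A.length := by
  have hcount : Nat.count (fun i => letterAt (A ++ 2 :: B) i = 2) A.length = A.count 2 := by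
    rw [← count_letterAt A 2]
    exact count_congr_of_lt fun i hi => by rw [letterAt_append_left hi]; rfl
  rw [← hcount]
  exact nthBelow_count (by simp) (letterAt_append_right A (2 :: B) 0)

section joinWords

variable {ws : List (List (Fin 3))} {w : List (Fin 3)} {k : ℕ}

theorem joinWords_append (ws ws' : List (List (Fin 3))) :
    joinWords (ws ++ ws') = joinWords ws ++ joinWords ws' := List.flatMap_append

theorem joinWords_cons (w : List (Fin 3)) (ws : List (List (Fin 3))) :
    joinWords (w :: ws) = w ++ 2 :: joinWords ws := by
  rw [joinWords, List.flatMap_cons, List.append_assoc, List.singleton_append, joinWords]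

theorem count_joinWords (h : ∀ w ∈ ws, 2 ∉ w) : (joinWords ws).count 2 = ws.length := by
  induction ws with
  | nil => rfl
  | cons w ws ih =>
    rw [joinWords_cons, List.count_append, List.count_cons_self,
      ih fun w hw => h w (List.mem_cons_of_mem _ hw),
      List.count_eq_zero_of_not_mem (h w List.mem_cons_self), zero_add, List.length_cons]

theorem joinWords_eq_of_getElem? (hk : ws[k]? = some w) : joinWords ws =
    joinWords (ws.take k) ++ w ++ 2 :: joinWords (ws.drop (k + 1)) := by
  obtain ⟨hlt, rfl⟩ := List.getElem?_eq_some_iff.1 hk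
  rw [List.append_assoc, ← joinWords_cons, ← List.drop_eq_getElem_cons hlt, ← joinWords_append,
    List.take_append_drop]

theorem length_joinWords_take_succ (hk : ws[k]? = some w) :
    (joinWords (ws.take (k + 1))).length = (joinWords (ws.take k)).length + w.length + 1 := by
  rw [List.take_add_one, hk, Option.toList_some, joinWords_append, joinWords_cons]
  simp [joinWords, add_assoc]

theorem sepPos_joinWords (h : ∀ w ∈ ws, 2 ∉ w) (hk : ws[k]? = some w) (rest : List (Fin 3)) :
    sepPos (joinWords ws ++ rest) k = (joinWords (ws.take k)).length + w.length := by
  have hcount : (joinWords (ws.take k) ++ w).count 2 = k := by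
    rw [List.count_append, count_joinWords fun w hw => h w (List.mem_of_mem_take hw),
      List.count_eq_zero_of_not_mem (h w (List.mem_of_getElem? hk)), add_zero, List.length_take]
    exact min_eq_left (List.getElem?_eq_some_iff.1 hk).1.le
  rw [← List.length_append, joinWords_eq_of_getElem? hk, List.append_assoc, List.cons_append]
  simpa only [hcount] using sepPos_append_cons (joinWords (ws.take k) ++ w) _

theorem sepPos_joinWords_add_one (h : ∀ w ∈ ws, 2 ∉ w) (hk : k < ws.length) (rest : List (Fin 3)) :
    sepPos (joinWords ws ++ rest) k + 1 = (joinWords (ws.take (k + 1))).length := by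
  have hw := List.getElem?_eq_getElem hk
  rw [sepPos_joinWords h hw, length_joinWords_take_succ hw]

theorem sepPos_joinWords_succ (h : ∀ w ∈ ws, 2 ∉ w) (hk : ws[k + 1]? = some w)
    (rest : List (Fin 3)) : sepPos (joinWords ws ++ rest) (k + 1) =
      sepPos (joinWords ws ++ rest) k + 1 + w.length := by
  rw [sepPos_joinWords h hk, sepPos_joinWords_add_one h
    ((Nat.lt_succ_self k).trans (List.getElem?_eq_some_iff.1 hk).1)]

theorem letterAt_joinWords_succ (h : ∀ w ∈ ws, 2 ∉ w) (hk : ws[k + 1]? = some w)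
    (rest : List (Fin 3)) {i : ℕ} (hi : i < w.length) :
    letterAt (joinWords ws ++ rest) (sepPos (joinWords ws ++ rest) k + 1 + i) = letterAt w i := by
  rw [sepPos_joinWords_add_one h ((Nat.lt_succ_self k).trans (List.getElem?_eq_some_iff.1 hk).1),
    joinWords_eq_of_getElem? hk, List.append_assoc, List.append_assoc, letterAt_append_right,
    letterAt_append_left hi]

end joinWords

end RAM

namespace EPGInstance

open RAM

variable (x : EPGInstance)

/-- The `q`-th label word in the encoding. -/
noncomputable def labelWordAt (q : Fin (x.n * x.n)) : List (Fin 3) :=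
  x.𝒢.labelWord (finProdFinEquiv.symm q).1 (finProdFinEquiv.symm q).2

/-- The words in the encoding that are terminated by `2`. -/
noncomputable def words : List (List (Fin 3)) :=
  List.replicate x.n 1 :: List.ofFn x.labelWordAt ++ [List.replicate x.m 1]

open Classical in
/-- The adjacency matrix of `H`, row by row. -/
noncomputable def matrix : List (Fin 3) :=
  List.ofFn fun q =>
    if x.H.Adj (finProdFinEquiv.symm q).1 (finProdFinEquiv.symm q).2 then 1 else 0

theorem encode_eq : x.encode = joinWords x.words ++ x.matrix := by
  classical
  have hlabel : List.ofFn x.labelWordAt = _ := (flatMap_finRange_eq_ofFn x.𝒢.labelWord).symm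
  rw [encode, EPG.encode, SimpleGraph.encode, words, joinWords_append, matrix,
    ← flatMap_finRange_eq_ofFn fun u v => if x.H.Adj u v then (1 : Fin 3) else 0, hlabel]
  simp [joinWords, List.flatMap_assoc, List.flatMap_map]

theorem length_words : x.words.length = x.n * x.n + 2 := by
  simp [words]

variable {x} in
theorem two_notMem_labelWordAt {q : Fin (x.n * x.n)} : 2 ∉ x.labelWordAt q := by
  rw [labelWordAt, EPG.labelWord]
  split_ifs
  · simp only [List.mem_map, not_exists, not_and]
    rintro (_ | _) _ <;> decide
  · exact List.not_mem_nil

theorem two_notMem_of_mem_words : ∀ w ∈ x.words, 2 ∉ w := by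
  intro w hw
  simp only [words, List.cons_append, List.mem_cons, List.mem_append, List.not_mem_nil, or_false,
    List.mem_ofFn] at hw
  rcases hw with rfl | ⟨q, rfl⟩ | rfl
  · simp [List.mem_replicate]
  · exact two_notMem_labelWordAt
  · simp [List.mem_replicate]

theorem words_getElem?_succ (q : Fin (x.n * x.n)) :
    x.words[(q : ℕ) + 1]? = some (x.labelWordAt q) := by
  simp [words]

theorem words_getElem?_last : x.words[x.n * x.n + 1]? = some (List.replicate x.m 1) := by
  simp [words]

/-- The length of the `q`-th label word, as read off the encoding. -/
noncomputable def wordLen (q : ℕ) : ℕ := sepPos x.encode (q + 1) - (sepPos x.encode q + 1)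

/-- The letter at position `i` of the `q`-th label word, as read off the encoding. -/
noncomputable def wordLetter (q i : ℕ) : ℕ := letterAt x.encode (sepPos x.encode q + 1 + i)

theorem wordLen_le_length (q : ℕ) : x.wordLen q ≤ x.encode.length :=
  (Nat.sub_le _ _).trans (nthBelow_le _)

theorem wordLen_eq_of_words {q : ℕ} {w : List (Fin 3)} (hw : x.words[q + 1]? = some w) :
    x.wordLen q = w.length := by
  rw [wordLen, encode_eq, sepPos_joinWords_succ x.two_notMem_of_mem_words hw,
    Nat.add_sub_cancel_left]

theorem wordLen_eq (q : Fin (x.n * x.n)) : x.wordLen q = (x.labelWordAt q).length :=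
  x.wordLen_eq_of_words (x.words_getElem?_succ q)

theorem wordLetter_eq {q : Fin (x.n * x.n)} {i : ℕ} (hi : i < x.wordLen q) :
    x.wordLetter q i = letterAt (x.labelWordAt q) i := by
  rw [wordLen_eq] at hi
  rw [wordLetter, encode_eq,
    letterAt_joinWords_succ x.two_notMem_of_mem_words (x.words_getElem?_succ q) _ hi]

theorem n_eq : x.n = sepPos x.encode 0 := by
  rw [encode_eq, sepPos_joinWords (w := List.replicate x.n 1) x.two_notMem_of_mem_words rfl]
  simp [joinWords]

theorem m_eq : x.m = x.wordLen (x.n * x.n) := by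
  rw [wordLen_eq_of_words _ x.words_getElem?_last, List.length_replicate]

theorem H_adj_iff (h h' : Fin x.m) : x.H.Adj h h' ↔
    letterAt x.encode (sepPos x.encode (x.n * x.n + 1) + 1 + finProdFinEquiv (h, h')) = 1 := by
  classical
  rw [encode_eq, sepPos_joinWords_add_one x.two_notMem_of_mem_words (by simp [length_words]),
    List.take_of_length_le x.length_words.le, letterAt_append_right, matrix,
    letterAt_eq_getElem (by simpa only [List.length_ofFn] using (finProdFinEquiv (h, h')).isLt),
    List.getElem_ofFn]
  simp only [Fin.eta, Equiv.symm_apply_apply]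
  by_cases hA : x.H.Adj h h' <;> simp [hA]

theorem snapshot_adj_iff (t : ℕ) (u v : Fin x.n) : (x.𝒢.snapshot t).Adj u v ↔
    x.wordLen (finProdFinEquiv (u, v)) ≠ 0 ∧ x.wordLetter (finProdFinEquiv (u, v))
      (t % x.wordLen (finProdFinEquiv (u, v))) = 1 := by
  have hw : x.labelWordAt (finProdFinEquiv (u, v)) = x.𝒢.labelWord u v := by simp [labelWordAt]
  by_cases h : s(u, v) ∈ x.𝒢.graph.edgeSet
  · rw [EPG.labelWord, dif_pos h] at hw
    have hlen : x.wordLen (finProdFinEquiv (u, v)) = (x.𝒢.label ⟨s(u, v), h⟩).length := by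
      rw [wordLen_eq, hw, List.length_map]
    have hpos : 0 < (x.𝒢.label ⟨s(u, v), h⟩).length := List.length_pos_of_mem (x.𝒢.one_mem _)
    have hmod := Nat.mod_lt t hpos
    have hsnapshot : (x.𝒢.snapshot t).Adj u v ↔ periodicLetter (x.𝒢.label ⟨s(u, v), h⟩) t = true :=
      ⟨fun ⟨_, h⟩ => h, fun h' => ⟨h, h'⟩⟩
    rw [hsnapshot, periodicLetter, List.getD_eq_getElem _ _ hmod, wordLetter_eq _ (hlen ▸ hmod),
      hlen, hw, letterAt_eq_getElem (by simpa using hmod), List.getElem_map]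
    cases (x.𝒢.label ⟨s(u, v), h⟩)[t % (x.𝒢.label ⟨s(u, v), h⟩).length] <;> simp [hpos.ne']
  · rw [EPG.labelWord, dif_neg h] at hw
    exact iff_of_false (fun ⟨hmem, _⟩ => h hmem) fun hne => hne.1 (by rw [wordLen_eq, hw]; rfl)

/-! ### Candidate times -/

/-- The number of occurrences of the letter `b` in the `q`-th label word. -/
noncomputable def letterCount (b q : ℕ) : ℕ :=
  Nat.count (fun i => x.wordLetter q i = b) (x.wordLen q)

/-- The maximal number of occurrences of the letter `b` in a label word. -/
noncomputable def maxCount (b : ℕ) : ℕ := (Finset.range (x.n * x.n)).sup (x.letterCount b)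

/-- The maximal number of occurrences of the rare letter in a label word. -/
noncomputable def rareCount : ℕ := min (x.maxCount 0) (x.maxCount 1)

/-- The letter among `0` and `1` whose maximal number of occurrences in a label word is smaller. -/
noncomputable def rareLetter : ℕ := if x.maxCount 0 ≤ x.maxCount 1 then 0 else 1

theorem maxCount_le {c : Fin 3} {d : Bool} (hcd : c = if d then 1 else 0) :
    x.maxCount c ≤ ⨆ e, (x.𝒢.label e).count d := by
  refine Finset.sup_le fun q hq => ?_
  lift q to Fin (x.n * x.n) using Finset.mem_range.1 hq
  have hcount : x.letterCount c q = (x.labelWordAt q).count c := by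
    rw [← count_letterAt, ← wordLen_eq]
    exact count_congr_of_lt fun i hi => by rw [wordLetter_eq _ hi]
  rw [hcount, labelWordAt, EPG.labelWord]
  split
  next h =>
    rw [hcd, List.count_map_of_injective _ (fun b : Bool => if b then (1 : Fin 3) else 0)
      (by decide)]
    exact le_ciSup (f := fun e => (x.𝒢.label e).count d) (Set.finite_range _).bddAbove ⟨_, h⟩
  next => exact Nat.zero_le _

theorem rareCount_le_param : x.rareCount ≤ x.param :=
  le_add_left (le_min ((min_le_right _ _).trans (x.maxCount_le (c := 1) (d := true) rfl))
    ((min_le_left _ _).trans (x.maxCount_le (c := 0) (d := false) rfl)))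

theorem letterCount_rareLetter_le {q : ℕ} (hq : q < x.n * x.n) :
    x.letterCount x.rareLetter q ≤ x.rareCount := by
  have hle (b : ℕ) : x.letterCount b q ≤ x.maxCount b :=
    Finset.le_sup (f := x.letterCount b) (Finset.mem_range.2 hq)
  rw [rareLetter, rareCount]
  split_ifs with h
  · exact (hle 0).trans (le_min le_rfl h)
  · exact (hle 1).trans (le_min (not_le.1 h).le le_rfl)

/-- The number of congruences that determine a snapshot: one for each possible occurrence of the
rare letter in a label word. -/
noncomputable def congruenceCount : ℕ := x.n * x.n * (x.rareCount + 1)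

/-- The modulus of the `e`-th congruence: the length of a label word, or `1` if that word is
empty. -/
noncomputable def modulus (e : ℕ) : ℕ := max 1 (x.wordLen (e / (x.rareCount + 1)))

/-- The remainder in the `e`-th congruence: the position of an occurrence of the rare letter in a
label word, or the length of that word if there is no such occurrence. -/
noncomputable def remainder (e : ℕ) : ℕ :=
  nthBelow (fun i => x.wordLetter (e / (x.rareCount + 1)) i = x.rareLetter)
    (x.wordLen (e / (x.rareCount + 1))) (e % (x.rareCount + 1))

/-- The modulus of the `e`-th congruence if the bit mask `c` requires it to hold, and `1`
otherwise. -/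
noncomputable def selectedModulus (c e : ℕ) : ℕ := if c.testBit e = true then x.modulus e else 1

/-- The `j`-th candidate for a time at which the congruences that hold are those in the bit mask
`c`. -/
noncomputable def timeAt (c j : ℕ) : ℕ :=
  residue (x.selectedModulus c) x.remainder x.congruenceCount +
    (Finset.range x.congruenceCount).lcm (x.selectedModulus c) * j

theorem modulus_le (e : ℕ) : x.modulus e ≤ x.encode.length + 1 :=
  max_le (Nat.le_add_left _ _) ((x.wordLen_le_length _).trans (Nat.le_succ _))

theorem selectedModulus_le (c e : ℕ) : x.selectedModulus c e ≤ x.encode.length + 1 := by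
  rw [selectedModulus]
  split_ifs
  exacts [x.modulus_le e, Nat.le_add_left _ _]

theorem remainder_le (e : ℕ) : x.remainder e ≤ x.encode.length :=
  (nthBelow_le _).trans (x.wordLen_le_length _)

variable {x} {t t' q i : ℕ}

theorem exists_modulus_eq_remainder_eq (hq : q < x.n * x.n) (hi : i < x.wordLen q)
    (h : x.wordLetter q i = x.rareLetter) :
    ∃ e < x.congruenceCount, x.modulus e = x.wordLen q ∧ x.remainder e = i := by
  set k := Nat.count (fun i => x.wordLetter q i = x.rareLetter) i
  have hlt : k < x.rareCount + 1 := Nat.lt_succ_of_le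
    ((Nat.count_monotone _ hi.le).trans (x.letterCount_rareLetter_le hq))
  have hdiv : ((x.rareCount + 1) * q + k) / (x.rareCount + 1) = q := by
    rw [Nat.mul_add_div (Nat.succ_pos _), Nat.div_eq_of_lt hlt, add_zero]
  have hmod : ((x.rareCount + 1) * q + k) % (x.rareCount + 1) = k := by
    rw [Nat.mul_add_mod, Nat.mod_eq_of_lt hlt]
  refine ⟨(x.rareCount + 1) * q + k, ?_, ?_, ?_⟩
  · calc (x.rareCount + 1) * q + k < (x.rareCount + 1) * (q + 1) := by rw [mul_add_one]; omega
      _ ≤ x.congruenceCount := by rw [mul_comm]; exact Nat.mul_le_mul_right _ hq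
  · rw [modulus, hdiv, max_eq_right (Nat.one_le_of_lt hi)]
  · rw [remainder, hmod]
    simp only [hdiv]
    exact nthBelow_count hi h

theorem wordLetter_mod_eq_rareLetter (hq : q < x.n * x.n) (hL : 0 < x.wordLen q)
    (h : ∀ e < x.congruenceCount, t ≡ x.remainder e [MOD x.modulus e] →
      t' ≡ x.remainder e [MOD x.modulus e])
    (ht : x.wordLetter q (t % x.wordLen q) = x.rareLetter) :
    x.wordLetter q (t' % x.wordLen q) = x.rareLetter := by
  obtain ⟨e, he, hmod, hrem⟩ := exists_modulus_eq_remainder_eq hq (Nat.mod_lt t hL) ht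
  have ht' := h e he
  rw [hmod, hrem] at ht'
  rwa [(ht' (Nat.mod_modEq t _).symm).trans (Nat.mod_modEq t _)]

theorem wordLetter_eq_zero_or_one (hq : q < x.n * x.n) (hi : i < x.wordLen q) :
    x.wordLetter q i = 0 ∨ x.wordLetter q i = 1 := by
  lift q to Fin (x.n * x.n) using hq
  have hlen := x.wordLen_eq q ▸ hi
  have hne : (x.labelWordAt q)[i] ≠ 2 := fun h =>
    two_notMem_labelWordAt (h ▸ List.getElem_mem hlen)
  rw [wordLetter_eq _ hi, letterAt_eq_getElem hlen]
  omega

theorem snapshot_eq_of_modEq_iff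
    (h : ∀ e < x.congruenceCount, t ≡ x.remainder e [MOD x.modulus e] ↔
      t' ≡ x.remainder e [MOD x.modulus e]) : x.𝒢.snapshot t = x.𝒢.snapshot t' := by
  ext u v
  rw [snapshot_adj_iff, snapshot_adj_iff]
  refine and_congr_right fun hL => ?_
  have hq := (finProdFinEquiv (u, v)).isLt
  generalize (finProdFinEquiv (u, v) : ℕ) = q at *
  have hL := Nat.pos_of_ne_zero hL
  have hrare : x.wordLetter q (t % x.wordLen q) = x.rareLetter ↔
      x.wordLetter q (t' % x.wordLen q) = x.rareLetter :=
    ⟨wordLetter_mod_eq_rareLetter hq hL fun e he => (h e he).1,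
      wordLetter_mod_eq_rareLetter hq hL fun e he => (h e he).2⟩
  have hletter := wordLetter_eq_zero_or_one hq (Nat.mod_lt t hL)
  have hletter' := wordLetter_eq_zero_or_one hq (Nat.mod_lt t' hL)
  have : x.rareLetter = 0 ∨ x.rareLetter = 1 := by
    rw [rareLetter]
    split_ifs <;> simp
  omega

theorem exists_snapshot_timeAt_eq (x : EPGInstance) (t : ℕ) :
    ∃ c < 2 ^ x.congruenceCount, ∃ j < 2 ^ x.congruenceCount,
      x.𝒢.snapshot (x.timeAt c j) = x.𝒢.snapshot t := by
  let c := Nat.ofBits fun e : Fin x.congruenceCount => decide (t ≡ x.remainder e [MOD x.modulus e])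
  have hsel (e : ℕ) (he : e < x.congruenceCount) :
      c.testBit e = true ↔ t ≡ x.remainder e [MOD x.modulus e] := by
    rw [Nat.testBit_ofBits_lt _ _ he, decide_eq_true_eq]
  obtain ⟨j, hj, hiff⟩ := exists_modEq_iff (p := x.remainder)
    (fun e => (le_max_left 1 _ : 1 ≤ x.modulus e)) t x.congruenceCount hsel
  exact ⟨c, Nat.ofBits_lt_two_pow _, j, hj, snapshot_eq_of_modEq_iff hiff⟩

end EPGInstance

/-! ### Reading an instance -/

namespace RAM

section Instance

open EPGInstance

variable {α : Type} {ι : α → EPGInstance} {Γ : Ctx encode param ι} {c e f i j k q : α → ℕ}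

namespace FPTComputable

theorem sepPos (hk : FPTComputable Γ k) : FPTComputable Γ fun a => sepPos (ι a).encode (k a) :=
  nthBelow .length hk fun _ _ _ E => .eq E.counter.computable.letterAt (const 2)

theorem wordLen (hq : FPTComputable Γ q) : FPTComputable Γ fun a => (ι a).wordLen (q a) :=
  (sepPos (hq.add (const 1))).sub ((sepPos hq).add (const 1))

theorem wordLetter (hq : FPTComputable Γ q) (hi : FPTComputable Γ i) :
    FPTComputable Γ fun a => (ι a).wordLetter (q a) (i a) :=
  (((sepPos hq).add (const 1)).add hi).letterAt

end FPTComputable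

namespace LoopBound

theorem wordLen (hq : FPTComputable Γ q) : LoopBound Γ fun a => (ι a).wordLen (q a) :=
  ⟨hq.wordLen, FPTBounded.length.mono fun a => (ι a).wordLen_le_length (q a)⟩

theorem paramBounded_n : ParamBounded (fun a => (ι a).param) fun a => (ι a).n :=
  ParamBounded.param.mono fun _ => Nat.le_add_right _ _

theorem n : LoopBound Γ fun a => (ι a).n :=
  of_paramBounded (by simpa only [n_eq] using .sepPos (.const 0)) paramBounded_n

theorem two_pow_n : LoopBound Γ fun a => 2 ^ (ι a).n :=
  of_paramBounded (.two_pow n) paramBounded_n.two_pow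

theorem two_pow_n_mul_n : LoopBound Γ fun a => 2 ^ ((ι a).n * (ι a).n) :=
  of_paramBounded (.two_pow (n.mul n)) (paramBounded_n.mul paramBounded_n).two_pow

theorem m : LoopBound Γ fun a => (ι a).m := by
  simpa only [m_eq] using wordLen (n.mul n).computable

end LoopBound

section Adjacency

variable {t : α → ℕ}

theorem FPTDecidable.H_adj {h h' : ∀ a, Fin (ι a).m} (hh : LoopBound Γ fun a => h a)
    (hh' : LoopBound Γ fun a => h' a) : FPTDecidable Γ fun a => (ι a).H.Adj (h a) (h' a) := by
  simp only [H_adj_iff, finProdFinEquiv_apply_val]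
  have hsep := FPTComputable.sepPos ((LoopBound.n (Γ := Γ).mul .n).computable.add (.const 1))
  exact .eq ((hsep.add (.const 1)).add (hh'.add (.mul .m hh)).computable).letterAt (.const 1)

theorem FPTDecidable.snapshot_adj (ht : FPTComputable Γ t) (hlog : LogBounded Γ t)
    {u v : ∀ a, Fin (ι a).n} (hu : LoopBound Γ fun a => u a) (hv : LoopBound Γ fun a => v a) :
    FPTDecidable Γ fun a => ((ι a).𝒢.snapshot (t a)).Adj (u a) (v a) := by
  simp only [snapshot_adj_iff, finProdFinEquiv_apply_val]
  have hq := (hv.add (.mul .n hu)).computable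
  exact .and (.not (.eq hq.wordLen (.const 0)))
    (.eq (.wordLetter hq (.mod ht hlog hq.wordLen)) (.const 1))

end Adjacency

theorem FPTComputable.maxCount (b : ℕ) : FPTComputable Γ fun a => (ι a).maxCount b :=
  sup (.mul .n .n) fun _ E => count (.wordLen E.counter.computable) fun _ E' =>
    .eq (.wordLetter (E.counter.lift E').computable E'.counter.computable) (.const b)

theorem FPTComputable.rareLetter : FPTComputable Γ fun a => (ι a).rareLetter :=
  ite (.le (.maxCount 0) (.maxCount 1)) (.const 0) (.const 1)

theorem paramBounded_rareCount : ParamBounded (fun a => (ι a).param) fun a => (ι a).rareCount :=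
  ParamBounded.param.mono fun a => (ι a).rareCount_le_param

theorem LoopBound.rareCount : LoopBound Γ fun a => (ι a).rareCount :=
  of_paramBounded (.min (.maxCount 0) (.maxCount 1)) paramBounded_rareCount

theorem LoopBound.congruenceCount : LoopBound Γ fun a => (ι a).congruenceCount :=
  .mul (.mul .n .n) (.add .rareCount (.const 1))

theorem LoopBound.two_pow_congruenceCount : LoopBound Γ fun a => 2 ^ (ι a).congruenceCount :=
  of_paramBounded (.two_pow .congruenceCount) (ParamBounded.two_pow
    ((paramBounded_n.mul paramBounded_n).mul (paramBounded_rareCount.add (.const 1))))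

namespace FPTComputable

theorem div_rareCount (he : LoopBound Γ e) :
    FPTComputable Γ fun a => e a / ((ι a).rareCount + 1) :=
  div he (LoopBound.rareCount.add (.const 1)).computable fun _ => Nat.succ_pos _

theorem modulus (he : LoopBound Γ e) : FPTComputable Γ fun a => (ι a).modulus (e a) :=
  .max (.const 1) (.wordLen (.div_rareCount he))

theorem remainder (he : LoopBound Γ e) : FPTComputable Γ fun a => (ι a).remainder (e a) := by
  have hq := div_rareCount he
  refine nthBelow (.wordLen hq) (.mod he.computable (.of_loopBound he)
    (LoopBound.rareCount.add (.const 1)).computable) fun Γ' E Γ'' E' => ?_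
  exact .eq (.wordLetter ((hq.lift E).lift E') E'.counter.computable) .rareLetter

theorem selectedModulus (hc : FPTComputable Γ c) (he : LoopBound Γ e) :
    FPTComputable Γ fun a => (ι a).selectedModulus (c a) (e a) :=
  .ite (.testBit hc he) (.modulus he) (.const 1)

theorem lcm_selectedModulus (hc : FPTComputable Γ c) (hk : LoopBound Γ k) :
    FPTComputable Γ fun a => (Finset.range (k a)).lcm ((ι a).selectedModulus (c a)) :=
  .lcm_range hk (.add .length (.const 1)) (fun a => (ι a).selectedModulus_le (c a))
    fun _ E => .selectedModulus (hc.lift E) E.counter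

theorem timeAt (hc : FPTComputable Γ c) (hj : LoopBound Γ j) :
    FPTComputable Γ fun a => (ι a).timeAt (c a) (j a) := by
  refine .add (.residue .congruenceCount (.add .length (.const 1))
    (fun a => (ι a).selectedModulus_le (c a)) fun Γ' E => ⟨?_, ?_, ?_⟩)
    (.mul (.lcm_selectedModulus hc .congruenceCount) hj)
  · exact .selectedModulus (hc.lift E) E.counter
  · exact ⟨.remainder E.counter, FPTBounded.length.mono fun x => (ι x.1).remainder_le x.2⟩
  · exact .lcm_selectedModulus (hc.lift E) E.counter

end FPTComputable

theorem LogBounded.timeAt (hj : LoopBound Γ j) :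
    LogBounded Γ fun a => (ι a).timeAt (c a) (j a) :=
  have hle a := (ι a).selectedModulus_le (c a)
  .add (.residue .congruenceCount (.add .length (.const 1)) hle)
    (.mul (.lcm_range .congruenceCount (.add .length (.const 1)) hle) (.of_loopBound hj))

end Instance

end RAM

/-! ### Searching for a time and for branch sets -/

theorem exists_testBit_iff {n : ℕ} (S : Fin n → Prop) :
    ∃ c : Fin (2 ^ n), ∀ i : Fin n, (c : ℕ).testBit i = true ↔ S i := by
  classical
  refine ⟨⟨Nat.ofBits fun i => decide (S i), Nat.ofBits_lt_two_pow _⟩, fun i => ?_⟩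
  rw [Nat.testBit_ofBits_lt _ _ i.isLt, decide_eq_true_eq]

theorem exists_testBit_finProdFinEquiv_iff {m n : ℕ} (hmn : m ≤ n) (R : Fin m → Fin n → Prop) :
    ∃ c : Fin (2 ^ (n * n)), ∀ h v, (c : ℕ).testBit (finProdFinEquiv (h, v)) = true ↔ R h v := by
  have hlt (h : Fin m) (v : Fin n) : (finProdFinEquiv (h, v) : ℕ) < n * n :=
    (finProdFinEquiv (h, v)).isLt.trans_le (Nat.mul_le_mul_right n hmn)
  obtain ⟨c, hc⟩ := exists_testBit_iff fun i : Fin (n * n) =>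
    ∃ h v, (finProdFinEquiv (h, v) : ℕ) = i ∧ R h v
  refine ⟨c, fun h v => (hc ⟨_, hlt h v⟩).trans ⟨fun ⟨h', v', he, hR⟩ => ?_, fun hR =>
    ⟨h, v, rfl, hR⟩⟩⟩
  obtain ⟨rfl, rfl⟩ := Prod.mk.inj (finProdFinEquiv.injective (Fin.ext he))
  exact hR

namespace RAM

section Search

variable {I : Type} {enc : I → List (Fin 3)} {par : I → ℕ} {α : Type} {ι : α → I}
  {Γ : Ctx enc par ι} {m n c : α → ℕ}

namespace FPTDecidable

theorem forall_set (hn : LoopBound Γ fun a => 2 ^ n a) {P : ∀ a, (Fin (n a) → Prop) → Prop}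
    (hP : ∀ Γ' : Ctx enc par fun x : (a : α) × Fin (2 ^ n a) => ι x.1, InLoop Γ' Γ →
      FPTDecidable Γ' fun x => P x.1 fun i => (x.2 : ℕ).testBit i = true) :
    FPTDecidable Γ fun a => ∀ S, P a S :=
  (forall_fin (R := fun a (c : Fin (2 ^ n a)) => P a fun i => (c : ℕ).testBit i = true)
    hn hP).congr fun a => ⟨fun h S => by
    obtain ⟨c, hc⟩ := exists_testBit_iff S
    simpa only [hc] using h c, fun h _ => h _⟩

theorem exists_rel (hn : LoopBound Γ fun a => 2 ^ (n a * n a))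
    {P : ∀ a, (Fin (m a) → Fin (n a) → Prop) → Prop} (hmn : ∀ a R, P a R → m a ≤ n a)
    (hP : ∀ Γ' : Ctx enc par fun x : (a : α) × Fin (2 ^ (n a * n a)) => ι x.1, InLoop Γ' Γ →
      FPTDecidable Γ' fun x => P x.1 fun h v => (x.2 : ℕ).testBit (finProdFinEquiv (h, v)) = true) :
    FPTDecidable Γ fun a => ∃ R, P a R :=
  (exists_fin (R := fun a (c : Fin (2 ^ (n a * n a))) =>
    P a fun h v => (c : ℕ).testBit (finProdFinEquiv (h, v)) = true) hn hP).congr fun a =>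
  ⟨fun ⟨_, h⟩ => ⟨_, h⟩, fun ⟨R, h⟩ => by
    obtain ⟨c, hc⟩ := exists_testBit_finProdFinEquiv_iff (hmn a R h) R
    exact ⟨c, by simpa only [hc] using h⟩⟩

theorem testBit_finProdFinEquiv (hc : FPTComputable Γ c) (hn : LoopBound Γ n)
    {h : ∀ a, Fin (m a)} {v : ∀ a, Fin (n a)} (hh : LoopBound Γ fun a => h a)
    (hv : LoopBound Γ fun a => v a) :
    FPTDecidable Γ fun a => (c a).testBit (finProdFinEquiv (h a, v a)) = true := by
  simp only [finProdFinEquiv_apply_val]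
  exact .testBit hc (hv.add (hn.mul hh))

theorem forall_exists_testBit (hc : FPTComputable Γ c) (hm : LoopBound Γ m) (hn : LoopBound Γ n) :
    FPTDecidable Γ fun a => ∀ h : Fin (m a), ∃ v : Fin (n a),
      (c a).testBit (finProdFinEquiv (h, v)) = true :=
  .forall_fin hm fun _ E => .exists_fin (hn.lift E) fun _ E' =>
    .testBit_finProdFinEquiv ((hc.lift E).lift E') ((hn.lift E).lift E') (E.counter.lift E')
      E'.counter

theorem disjoint_testBit (hc : FPTComputable Γ c) (hm : LoopBound Γ m) (hn : LoopBound Γ n) :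
    FPTDecidable Γ fun a => ∀ (h h' : Fin (m a)) (v : Fin (n a)),
      (c a).testBit (finProdFinEquiv (h, v)) = true →
        (c a).testBit (finProdFinEquiv (h', v)) = true → h = h' := by
  refine .forall_fin hm fun _ E => .forall_fin (hm.lift E) fun _ E' =>
    .forall_fin ((hn.lift E).lift E') fun _ E'' => ?_
  have hc := ((hc.lift E).lift E').lift E''
  have hn := ((hn.lift E).lift E').lift E''
  have hh := (E.counter.lift E').lift E''
  have hh' := E'.counter.lift E''
  exact .imp (.testBit_finProdFinEquiv hc hn hh E''.counter)
    (.imp (.testBit_finProdFinEquiv hc hn hh' E''.counter)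
      ((FPTDecidable.eq hh.computable hh'.computable).congr fun x => Fin.ext_iff.symm))

end FPTDecidable

end Search

section Instance

open EPGInstance

variable {α : Type} {ι : α → EPGInstance} {Γ : Ctx encode param ι} {c t : α → ℕ}

namespace FPTDecidable

theorem connected_testBit (hc : FPTComputable Γ c) (ht : FPTComputable Γ t)
    (hlog : LogBounded Γ t) :
    FPTDecidable Γ fun a => ∀ (h : Fin (ι a).m) (S : Fin (ι a).n → Prop),
      (∃ v, (c a).testBit (finProdFinEquiv (h, v)) = true ∧ S v) →
      (∃ v, (c a).testBit (finProdFinEquiv (h, v)) = true ∧ ¬ S v) →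
      ∃ v v', (c a).testBit (finProdFinEquiv (h, v)) = true ∧
        (c a).testBit (finProdFinEquiv (h, v')) = true ∧ S v ∧ ¬ S v' ∧
          ((ι a).𝒢.snapshot (t a)).Adj v v' := by
  refine .forall_fin .m fun _ E => .forall_set .two_pow_n fun _ E' => ?_
  have hc := (hc.lift E).lift E'
  have hh := E.counter.lift E'
  have hS := E'.counter
  refine .imp ?_ (.imp ?_ ?_)
  · exact .exists_fin .n fun _ F => .and
      (.testBit_finProdFinEquiv (hc.lift F) .n (hh.lift F) F.counter)
      (.testBit (hS.lift F).computable F.counter)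
  · exact .exists_fin .n fun _ F => .and
      (.testBit_finProdFinEquiv (hc.lift F) .n (hh.lift F) F.counter)
      (.not (.testBit (hS.lift F).computable F.counter))
  · refine .exists_fin .n fun _ F => .exists_fin .n fun _ F' => ?_
    have hc := (hc.lift F).lift F'
    have hh := (hh.lift F).lift F'
    have hS := ((hS.lift F).lift F').computable
    have hv := F.counter.lift F'
    have hv' := F'.counter
    exact .and (.testBit_finProdFinEquiv hc .n hh hv) (.and
      (.testBit_finProdFinEquiv hc .n hh hv') (.and (.testBit hS hv) (.and
        (.not (.testBit hS hv')) (.snapshot_adj ((((ht.lift E).lift E').lift F).lift F')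
          ((((hlog.lift E).lift E').lift F).lift F') hv hv'))))

theorem adj_testBit (hc : FPTComputable Γ c) (ht : FPTComputable Γ t) (hlog : LogBounded Γ t) :
    FPTDecidable Γ fun a => ∀ h h', (ι a).H.Adj h h' →
      ∃ v v', (c a).testBit (finProdFinEquiv (h, v)) = true ∧
        (c a).testBit (finProdFinEquiv (h', v')) = true ∧
          ((ι a).𝒢.snapshot (t a)).Adj v v' := by
  refine .forall_fin .m fun _ E => .forall_fin .m fun _ E' =>
    .imp (.H_adj (E.counter.lift E') E'.counter) ?_
  refine .exists_fin .n fun _ F => .exists_fin .n fun _ F' => ?_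
  have hc := (((hc.lift E).lift E').lift F).lift F'
  have hh := ((E.counter.lift E').lift F).lift F'
  have hh' := (E'.counter.lift F).lift F'
  have hv := F.counter.lift F'
  exact .and (.testBit_finProdFinEquiv hc .n hh hv) (.and
    (.testBit_finProdFinEquiv hc .n hh' F'.counter)
    (.snapshot_adj ((((ht.lift E).lift E').lift F).lift F')
      ((((hlog.lift E).lift E').lift F).lift F') hv F'.counter))

theorem adj_iff_testBit (hc : FPTComputable Γ c) (ht : FPTComputable Γ t)
    (hlog : LogBounded Γ t) :
    FPTDecidable Γ fun a => ∀ h h' v v', (c a).testBit (finProdFinEquiv (h, v)) = true →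
      (c a).testBit (finProdFinEquiv (h', v')) = true →
        ((ι a).H.Adj h h' ↔ ((ι a).𝒢.snapshot (t a)).Adj v v') := by
  refine .forall_fin .m fun _ E => .forall_fin .m fun _ E' => .forall_fin .n fun _ F =>
    .forall_fin .n fun _ F' => ?_
  have hc := (((hc.lift E).lift E').lift F).lift F'
  have hh := ((E.counter.lift E').lift F).lift F'
  have hh' := (E'.counter.lift F).lift F'
  have hv := F.counter.lift F'
  exact .imp (.testBit_finProdFinEquiv hc .n hh hv) (.imp
    (.testBit_finProdFinEquiv hc .n hh' F'.counter) (.iff (.H_adj hh hh')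
      (.snapshot_adj ((((ht.lift E).lift E').lift F).lift F')
        ((((hlog.lift E).lift E').lift F).lift F') hv F'.counter)))

end FPTDecidable

/-- The relation `Q` between the pattern of an instance and its snapshot can be tested in
fixed-parameter time at every computable time step. The time step may be exponentially large, as
long as its number of bits can be looped over. -/
def SnapshotTestable (Q : ∀ {m n : ℕ}, SimpleGraph (Fin m) → SimpleGraph (Fin n) → Prop) : Prop :=
  ∀ ⦃α : Type⦄ ⦃ι : α → EPGInstance⦄ ⦃Γ : Ctx encode param ι⦄ ⦃t : α → ℕ⦄,
    FPTComputable Γ t → LogBounded Γ t →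
      FPTDecidable Γ fun a => Q (ι a).H ((ι a).𝒢.snapshot (t a))

namespace SnapshotTestable

theorem not {Q : ∀ {m n : ℕ}, SimpleGraph (Fin m) → SimpleGraph (Fin n) → Prop}
    (hQ : SnapshotTestable Q) : SnapshotTestable fun H G => ¬ Q H G :=
  fun _ _ _ _ ht hlog => (hQ ht hlog).not

theorem isIndContained : SnapshotTestable fun H G => H.IsIndContained G := by
  intro α ι Γ t ht hlog
  simp only [isIndContained_iff_exists_isInducedCopy]
  refine .exists_rel .two_pow_n_mul_n (fun _ _ hR => by
    simpa using card_le_of_disjoint_nonempty hR.nonempty hR.disjoint) fun _ E => ?_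
  have hc := E.counter.computable
  exact FPTDecidable.congr (.and (.forall_exists_testBit hc .m .n)
    (.and (.disjoint_testBit hc .m .n) (.adj_iff_testBit hc (ht.lift E) (hlog.lift E)))) fun _ =>
      ⟨fun ⟨hne, hdisj, hadj⟩ => ⟨hne, hdisj, hadj⟩,
        fun hR => ⟨hR.nonempty, hR.disjoint, hR.adj_iff⟩⟩

theorem isMinorOf : SnapshotTestable fun H G => H.IsMinorOf G := by
  intro α ι Γ t ht hlog
  simp only [isMinorOf_iff_exists_isMinorModel]
  refine .exists_rel .two_pow_n_mul_n (fun _ _ hR => by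
    simpa using card_le_of_disjoint_nonempty hR.nonempty hR.disjoint) fun _ E => ?_
  have hc := E.counter.computable
  exact FPTDecidable.congr (.and (.forall_exists_testBit hc .m .n)
    (.and (.disjoint_testBit hc .m .n) (.and (.connected_testBit hc (ht.lift E) (hlog.lift E))
      (.adj_testBit hc (ht.lift E) (hlog.lift E))))) fun _ =>
        ⟨fun ⟨hne, hdisj, hconn, hadj⟩ => ⟨hne, hdisj, hconn, hadj⟩,
          fun hR => ⟨hR.nonempty, hR.disjoint, hR.connected, hR.adj⟩⟩

theorem isFPT {Q : ∀ {m n : ℕ}, SimpleGraph (Fin m) → SimpleGraph (Fin n) → Prop}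
    (hQ : SnapshotTestable Q) :
    ParamProblem.IsFPT ⟨EPGInstance, encode, param, fun x => ∃ t, Q x.H (x.𝒢.snapshot t)⟩ := by
  have search : FPTDecidable (.init encode param) fun x : EPGInstance =>
      ∃ c j : Fin (2 ^ x.congruenceCount), Q x.H (x.𝒢.snapshot (x.timeAt c j)) :=
    .exists_fin .two_pow_congruenceCount fun _ E => .exists_fin .two_pow_congruenceCount
      fun _ E' => hQ (.timeAt (E.counter.lift E').computable E'.counter) (.timeAt E'.counter)
  refine ParamProblem.isFPT_of_fptDecidable (search.congr fun x => ?_)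
  refine ⟨fun ⟨_, _, h⟩ => ⟨_, h⟩, fun ⟨t, h⟩ => ?_⟩
  obtain ⟨c, hc, j, hj, heq⟩ := x.exists_snapshot_timeAt_eq t
  exact ⟨⟨c, hc⟩, ⟨j, hj⟩, by rwa [heq]⟩

end SnapshotTestable

end Instance

end RAM

theorem mainTheorem7 :
    EPGSubgraph.IsFPT ∧ EPGSubgraphFree.IsFPT ∧ EPGMinor.IsFPT ∧ EPGMinorFree.IsFPT :=
  ⟨RAM.SnapshotTestable.isIndContained.isFPT, RAM.SnapshotTestable.isIndContained.not.isFPT,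
    RAM.SnapshotTestable.isMinorOf.isFPT, RAM.SnapshotTestable.isMinorOf.not.isFPT⟩
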